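/- Let $m,n,d\ge 0$ be integers with $m+n=d$ and $n\le d/4$. Let $S\subset\mathbb{R}^d$ be an (embedded) real-analytic submanifold of dimension $m$. We say that $S$ is totally curved at $p\in S$ if, for every $n$-dimensional subspace $V\subseteq T_pS$, the vectors $\mathrm{II}_p(v,x)$ ($v\in V$, $x\in T_pS$) span the normal space $(T_pS)^\perp$, where $\mathrm{II}_p$ is the second fundamental form; and that $S$ is totally curved if its totally curved points are dense in $S$. Assume that $S$ is totally curved. For a function $f$ on $\mathbb{R}^d$ put $\|f\|_{S^j}=\sum_{|a|\le j}\|\partial^a f\|_{L^\infty(\mathbb{R}^d)}\in[0,\infty]$. For $T,\alpha>0$, a function $f:\mathbb{R}^d\to\mathbb{C}$ of class $C^1$ is called $(T,\alpha)$-singular, with cutoff $\tilde\rho$, if $\|f\|_{S^0}\le 1$, $\|f\|_{S^1}\le T$, $$\Big|\int_{\mathbb{R}^d} f(x)\psi(x)\,dx\Big|\le T^{-\alpha}\|\psi\|_{S^{4d}}$$ for every $\psi\in C^\infty(\mathbb{R}^d)$ for which $f\psi$ is integrable, and there are an integer $0\le k\le d/2$ and a function $\tilde f:\mathbb{R}^k\to\mathbb{C}$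 such that $f(x_1,x_2)=\tilde f(x_1)\tilde\rho(x_2)$ for all $(x_1,x_2)\in\mathbb{R}^k\times\mathbb{R}^{d-k}$, where $\tilde\rho\in C_c^\infty(\mathbb{R}^{d-k})$ is real-valued and $\|\tilde\rho\|_{S^1}\le 1\le\int_{\mathbb{R}^{d-k}}\tilde\rho$. Let $K\subseteq S$ be compact and let $\alpha>0$. Then there is $c>0$, depending only on $\alpha$, $S$ and $K$ (so only on $\alpha$ and $S$ if $S$ is compact), with the following property. Let $\lambda_S$ be any probability measure on $S$ which has a $C^\infty$ density, supported in $K$, with respect to the $m$-dimensional volume measure of $S$, and let $R>0$. Then there is a constant $C$, depending only on $\alpha$, $\lambda_S$, $S$, $K$ and $R$, such that for every $T>0$ and every $(T,\alpha)$-singular function $f$ whose cutoff $\tilde\rho$ is supported in some ball of radius $R$, $$\Big|\int_{\mathbb{R}^d} f\,d\lambda_S\Big|\le C\,T^{-c}.$$ -/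

import Mathlib

open MeasureTheory Set
open scoped ENNReal ContDiff

noncomputable section

/-- `ℝᵈ` with its Euclidean structure. -/
abbrev Eucl (d : ℕ) : Type := EuclideanSpace ℝ (Fin d)

/-! ### Sobolev norms -/

/-- The `L^∞` Sobolev norm `‖f‖_{S^j}` on `ℝᵈ`: the sum of the sup norms of all partial derivatives
of order at most `j`. The monomials of degree `l` in `∂₁, …, ∂_d` are indexed by the
nondecreasing words of length `l` in the indices. The value is `∞` when one of the derivatives
is unbounded. -/
def sobolevNorm {d : ℕ} {F : Type*} [NormedAddCommGroup F] [NormedSpace ℝ F]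
    (j : ℕ) (f : Eucl d → F) : ℝ≥0∞ :=
  open Classical in
  ∑ l ∈ Finset.range (j + 1), ∑ w : Fin l → Fin d with Monotone w,
    ⨆ x : Eucl d, ‖iteratedFDeriv ℝ l f x (fun i => EuclideanSpace.single (w i) (1 : ℝ))‖ₑ

/-! ### Real-analytic submanifolds and total curvature -/

/-- `φ : V → S` is a regular real-analytic local parametrization of `S ⊆ ℝᵈ` by an open set
`V ⊆ ℝᵐ`: an analytic immersion which is a homeomorphism onto a relatively open part of `S`. -/
structure IsLocalParam {m d : ℕ} (S : Set (Eucl d)) (V : Set (Eucl m))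
    (φ : Eucl m → Eucl d) : Prop where
  isOpen_source : IsOpen V
  analytic : AnalyticOnNhd ℝ φ V
  immersion : ∀ t ∈ V, Function.Injective (fderiv ℝ φ t)
  embedding : Topology.IsEmbedding (fun t : V => φ t)
  image_open : ∃ U : Set (Eucl d), IsOpen U ∧ φ '' V = S ∩ U

/-- `S` is an (embedded) real-analytic submanifold of `ℝᵈ` of dimension `m`. -/
def IsAnalyticSubmanifold {d : ℕ} (m : ℕ) (S : Set (Eucl d)) : Prop :=
  ∀ p ∈ S, ∃ (V : Set (Eucl m)) (φ : Eucl m → Eucl d), IsLocalParam S V φ ∧ p ∈ φ '' V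

/-- The tangent space at `φ t` of the manifold parametrized by `φ`. -/
def paramTangent {m d : ℕ} (φ : Eucl m → Eucl d) (t : Eucl m) : Submodule ℝ (Eucl d) :=
  LinearMap.range (fderiv ℝ φ t : Eucl m →ₗ[ℝ] Eucl d)

/-- The second fundamental form at `φ t`, evaluated at the tangent vectors `Dφ(t) a` and
`Dφ(t) b`: the normal component of `D²φ(t)(a, b)`, which is the derivative in the direction
`Dφ(t) a` of the tangent field `Dφ(·) b`. -/
def secondFundamentalForm {m d : ℕ} (φ : Eucl m → Eucl d) (t a b : Eucl m) : Eucl d :=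
  (paramTangent φ t)ᗮ.starProjection (fderiv ℝ (fderiv ℝ φ) t a b)

/-- `S` (of dimension `m` in `ℝᵈ`, codimension `n = d - m`) is totally curved at `p`: for every
`n`-dimensional subspace `W` of the tangent space, `II_p(W × T_pS)` spans the normal space. -/
def IsTotallyCurvedAt {d : ℕ} (m : ℕ) (S : Set (Eucl d)) (p : Eucl d) : Prop :=
  ∃ (V : Set (Eucl m)) (φ : Eucl m → Eucl d) (t : Eucl m),
    IsLocalParam S V φ ∧ t ∈ V ∧ φ t = p ∧
    ∀ W : Submodule ℝ (Eucl d), W ≤ paramTangent φ t → Module.finrank ℝ W + m = d →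
      Submodule.span ℝ {v | ∃ a b : Eucl m, fderiv ℝ φ t a ∈ W ∧
        v = secondFundamentalForm φ t a b} = (paramTangent φ t)ᗮ

/-- `S` is totally curved: its totally curved points are dense in `S`. -/
def IsTotallyCurved {d : ℕ} (m : ℕ) (S : Set (Eucl d)) : Prop :=
  S ⊆ closure {p ∈ S | IsTotallyCurvedAt m S p}

/-! ### Measures on `S` with smooth compactly supported density -/

/-- `g` restricts to a `C^∞` function on the `m`-dimensional submanifold `S`. -/
def IsSmoothOnSubmanifold {d : ℕ} (m : ℕ) (S : Set (Eucl d)) (g : Eucl d → ℝ) : Prop :=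
  ∀ (V : Set (Eucl m)) (φ : Eucl m → Eucl d), IsLocalParam S V φ → ContDiffOn ℝ ∞ (g ∘ φ) V

/-- `lam` is a probability measure `g · vol_S` where `vol_S` is the `m`-dimensional volume measure on
`S` and `g ≥ 0` is a smooth function on `S` which vanishes outside `K`. -/
def IsSmoothProbabilityOn {d : ℕ} (m : ℕ) (S K : Set (Eucl d)) (lam : Measure (Eucl d)) : Prop :=
  IsProbabilityMeasure lam ∧
  ∃ g : Eucl d → ℝ, IsSmoothOnSubmanifold m S g ∧ (∀ x ∈ S, 0 ≤ g x) ∧ (∀ x ∈ S, x ∉ K → g x = 0) ∧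
    lam = ((μHE[m] : Measure (Eucl d)).restrict S).withDensity (fun x => ENNReal.ofReal (g x))

/-! ### Singular functions -/

/-- The first `k` coordinates of a point of `ℝᵈ`. -/
def headCoords {d k : ℕ} (hk : 2 * k ≤ d) (x : Eucl d) : Eucl k :=
  WithLp.toLp 2 (fun i : Fin k => x ⟨i, by omega⟩)

/-- The last `d - k` coordinates of a point of `ℝᵈ`. -/
def tailCoords {d : ℕ} (k : ℕ) (x : Eucl d) : Eucl (d - k) :=
  WithLp.toLp 2 (fun i : Fin (d - k) => x ⟨k + i, by omega⟩)

/-- `f` is a `(T, α)`-singular function on `ℝᵈ` whose cutoff factor `ρ` is supported in a ball of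
radius `R`. The bound against `ψ` is void when `ψ` has infinite Sobolev norm. -/
structure IsSingularFunction {d : ℕ} (T α R : ℝ) (f : Eucl d → ℂ) : Prop where
  contDiff : ContDiff ℝ 1 f
  norm_zero : sobolevNorm 0 f ≤ 1
  norm_one : sobolevNorm 1 f ≤ ENNReal.ofReal T
  equidistributed : ∀ ψ : Eucl d → ℂ, ContDiff ℝ ∞ ψ → Integrable (fun x => f x * ψ x) →
    ‖∫ x, f x * ψ x‖ₑ ≤ ENNReal.ofReal (T ^ (-α)) * sobolevNorm (4 * d) ψ
  factorization : ∃ (k : ℕ) (hk : 2 * k ≤ d) (ft : Eucl k → ℂ) (ρ : Eucl (d - k) → ℝ),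
    (∀ x, f x = ft (headCoords hk x) * (ρ (tailCoords k x) : ℂ)) ∧
    ContDiff ℝ ∞ ρ ∧ (∃ a, tsupport ρ ⊆ Metric.closedBall a R) ∧
    sobolevNorm 1 ρ ≤ 1 ∧ 1 ≤ ∫ y, ρ y

end

/-!
The proof shows that `lam` is Hölder continuous under translations of `k` of the coordinates, and
combines this with the equidistribution of `f`.

Let `π` be the projection of `ℝᵈ` to its first `k ≤ d / 2` coordinates. If `π` restricted to `S` were
nowhere a submersion on an open piece of `S`, then at a totally curved point of locally maximal
rank there would be a nonzero normal vector `w` of the form `π* y`, with `y` orthogonal to the image of the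
tangent space. The kernel of `π` on the tangent space has dimension at least `m - k + 1 > n`. Where
the rank of `d(π ∘ φ)` is locally constant, its derivative maps its kernel into its range, which
says that `⟨w, II(a, b)⟩ = 0` whenever `a` lies in this kernel; this contradicts total curvature
(`IsTotallyCurved.not_eventually_finrank_lt`). Hence in each analytic chart the Gram determinant
`D` of `d(π ∘ φ)` is an analytic function which vanishes identically near no point, and its
sublevel sets `{|D| ≤ ε}` have measure `O(ε ^ γ)` (`AnalyticAt.exists_volume_sublevel_le`).

By Cramer's rule the coordinate fields of `ℝᵏ`, multiplied by `D`, lift to smooth vector fields on the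
chart. Split a density `b` as `b D² / (D² + ε) + b ε / (D² + ε)`. On the first part, a translation by
`v` can be carried out by integration by parts along the lifted fields, at the cost
`O(‖v‖ / ε²)`; the second part is concentrated near `{D = 0}`. Optimizing in `ε` shows that
`∫ w (u (π x + v) - u (π x)) dlam = O(‖v‖ ^ c)`, uniformly in bounded `u` and in weights `w` bounded in `C¹`
(`IsTotallyCurved.exists_norm_integral_translate_sub_le`). Passing between the volume measure of
`S` and charts uses the area formula for the Hausdorff measure.

Finally, let `f x = ft (π x) * ρ x₂` be singular, where `x₂` stands for the last `d - k`
coordinates. Since `ρ` has integral at least `1` and a support of bounded size, it is at least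
`κ > 0` at some point `y₀`, so that `f x = (ρ y₀)⁻¹ * ρ x₂ * u (π x)` with `u x₁ = f (x₁, y₀)`
bounded. By translation continuity, `u` can be replaced in the integral against `lam` by its
averages at a scale `δ`, with an error `O(δ ^ c)`. Equidistribution of `f` bounds these averages by
`O(δ⁻⁵ᵈ T ^ (-α) + δ)`, because `ρ` is Lipschitz (`norm_integral_le_of_norm_average_le`).
Taking a small power of `T⁻¹` for `δ` gives the result.
-/

open scoped Topology NNReal

/-! ### Sublevel sets of analytic functions -/

/-- One-dimensional core: if the values `g 0` are at most `ε` at `2 ^ N` points with gaps `≥ η`, then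
the `N`-th derivative is at most `ε (2/η)^N` somewhere. -/
theorem exists_abs_iterate_deriv_le (a b η : ℝ) (hη : 0 < η) (N : ℕ) :
    ∀ (g : ℕ → ℝ → ℝ) (ε : ℝ),
      (∀ j, ∀ s ∈ Icc a b, HasDerivAt (g j) (g (j + 1) s) s) →
      ∀ x : ℕ → ℝ, (∀ i < 2 ^ N, x i ∈ Icc a b ∧ |g 0 (x i)| ≤ ε) →
        (∀ i, i + 1 < 2 ^ N → x i + η ≤ x (i + 1)) →
        ∃ ξ ∈ Icc a b, |g N ξ| ≤ ε * (2 / η) ^ N := by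
  induction N with
  | zero =>
    intro g ε _ x hx _
    exact ⟨x 0, (hx 0 (by norm_num)).1, by simpa using (hx 0 (by norm_num)).2⟩
  | succ N ih =>
    intro g ε hg x hx hgap
    have hp : 2 ^ (N + 1) = 2 * 2 ^ N := by ring
    have key : ∀ i < 2 ^ N, ∃ y, x (2 * i) ≤ y ∧ y ≤ x (2 * i + 1) ∧ y ∈ Icc a b ∧
        |g 1 y| ≤ ε * (2 / η) := by
      intro i hi
      have h1 := hx (2 * i) (by omega)
      have h2 := hx (2 * i + 1) (by omega)
      have h3 := hgap (2 * i) (by omega)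
      have hlt : x (2 * i) < x (2 * i + 1) := by linarith
      have hsub : Icc (x (2 * i)) (x (2 * i + 1)) ⊆ Icc a b := Icc_subset_Icc h1.1.1 h2.1.2
      obtain ⟨y, hy, hy'⟩ := exists_hasDerivAt_eq_slope (g 0) (g 1) hlt
        (fun s hs => (hg 0 s (hsub hs)).continuousAt.continuousWithinAt)
        (fun s hs => hg 0 s (hsub (Ioo_subset_Icc_self hs)))
      refine ⟨y, hy.1.le, hy.2.le, hsub (Ioo_subset_Icc_self hy), ?_⟩
      rw [hy', abs_div, abs_of_pos (sub_pos.2 hlt)]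
      have h4 : |g 0 (x (2 * i + 1)) - g 0 (x (2 * i))| ≤ 2 * ε := by
        calc _ ≤ |g 0 (x (2 * i + 1))| + |g 0 (x (2 * i))| := abs_sub _ _
          _ ≤ _ := by linarith [h1.2, h2.2]
      have h5 : 0 ≤ 2 * ε := le_trans (abs_nonneg _) h4
      calc _ ≤ 2 * ε / η := div_le_div₀ h5 h4 hη (by linarith)
        _ = _ := by ring
    choose! y hy using key
    obtain ⟨ξ, hξ, hle⟩ := ih (fun j => g (j + 1)) (ε * (2 / η)) (fun j => hg (j + 1)) y
      (fun i hi => (hy i hi).2.2) (fun i hi => by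
        have h1 := (hy i (by omega)).2.1
        have h2 := (hy (i + 1) hi).1
        have h3 := hgap (2 * i + 1) (by omega)
        have : 2 * (i + 1) = 2 * i + 1 + 1 := by ring
        rw [this] at h2
        linarith)
    exact ⟨ξ, hξ, hle.trans (le_of_eq (by ring))⟩

/-- A bounded set of reals either contains `P` points with gaps `≥ η` or has measure `≤ 2 P η`. -/
theorem exists_separated_or_volume_le (a b η : ℝ) (hη : 0 < η) (P : ℕ) :
    ∀ A : Set ℝ, A ⊆ Icc a b →
      (∃ x : ℕ → ℝ, (∀ i < P, x i ∈ A) ∧ ∀ i, i + 1 < P → x i + η ≤ x (i + 1)) ∨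
        volume A ≤ ENNReal.ofReal (2 * P * η) := by
  induction P with
  | zero => exact fun A _ => Or.inl ⟨0, by simp, by simp⟩
  | succ P ih =>
    intro A hA
    rcases A.eq_empty_or_nonempty with rfl | hne
    · right; simp
    have hbdd : BddBelow A := ⟨a, fun x hx => (hA hx).1⟩
    obtain ⟨x₀, hx₀, hlt⟩ := exists_lt_of_csInf_lt hne (show sInf A < sInf A + η by linarith)
    rcases ih (A ∩ Ici (x₀ + η)) (inter_subset_left.trans hA) with ⟨x, hx, hgap⟩ | hvol
    · left
      refine ⟨fun i => if i = 0 then x₀ else x (i - 1), ?_, ?_⟩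
      · intro i hi
        rcases i with _ | i
        · simpa using hx₀
        · simpa using (hx i (by omega)).1
      · intro i hi
        rcases i with _ | i
        · simpa using (hx 0 (by omega)).2
        · simpa using hgap i (by omega)
    · right
      have hsub : A ⊆ Icc (sInf A) (sInf A + 2 * η) ∪ (A ∩ Ici (x₀ + η)) := by
        intro y hy
        rcases le_or_gt (x₀ + η) y with h | h
        · exact Or.inr ⟨hy, h⟩
        · exact Or.inl ⟨csInf_le hbdd hy, by linarith⟩
      calc volume A ≤ volume (Icc (sInf A) (sInf A + 2 * η)) + volume (A ∩ Ici (x₀ + η)) :=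
            (measure_mono hsub).trans (measure_union_le _ _)
        _ ≤ ENNReal.ofReal (2 * η) + ENNReal.ofReal (2 * P * η) := by
            gcongr
            rw [Real.volume_Icc]; simp
        _ = _ := by
            rw [← ENNReal.ofReal_add (by positivity) (by positivity)]
            congr 1; push_cast; ring

/-- Sublevel estimate on an interval: if `|g N| ≥ κ` there, where `g j` are the successive derivatives
of `g 0`, then `{|g 0| ≤ ε}` has measure `O(ε ^ (1 / (2 N + 1)))` for small `ε`. -/
theorem volume_sublevel_interval_le (a b κ : ℝ) (N : ℕ) (g : ℕ → ℝ → ℝ)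
    (hg : ∀ j, ∀ s ∈ Icc a b, HasDerivAt (g j) (g (j + 1) s) s)
    (hκ : ∀ s ∈ Icc a b, κ ≤ |g N s|) {η : ℝ} (hη : 0 < η) (hη' : 2 ^ N * η ^ (N + 1) < κ) :
    volume {s ∈ Icc a b | |g 0 s| ≤ η ^ (2 * N + 1)} ≤ ENNReal.ofReal (2 * 2 ^ N * η) := by
  rcases exists_separated_or_volume_le a b η hη (2 ^ N) {s ∈ Icc a b | |g 0 s| ≤ η ^ (2 * N + 1)}
    (fun s hs => hs.1) with ⟨x, hx, hgap⟩ | h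
  · exfalso
    obtain ⟨ξ, hξ, hle⟩ := exists_abs_iterate_deriv_le a b η hη N g _ hg x hx hgap
    have : η ^ (2 * N + 1) * (2 / η) ^ N = 2 ^ N * η ^ (N + 1) := by
      rw [div_pow]
      field_simp
      ring
    linarith [hκ ξ hξ]
  · simpa using h

/-- Sublevel estimate on a ball, deduced from the one on segments in direction `u` by averaging over
the translates of the sublevel set along `u`. -/
theorem volume_sublevel_ball_le {E : Type*} [NormedAddCommGroup E] [NormedSpace ℝ E]
    [FiniteDimensional ℝ E] [MeasurableSpace E] [BorelSpace E] (μ : Measure E) [μ.IsAddHaarMeasure]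
    {t₀ u : E} {r κ : ℝ} (hr : 0 < r) (hu : ‖u‖ ≤ 1) (N : ℕ) (D : ℕ → E → ℝ)
    (hc : ContinuousOn (D 0) (Metric.ball t₀ (4 * r)))
    (hD : ∀ j, ∀ t ∈ Metric.ball t₀ (4 * r), HasLineDerivAt ℝ (D j) (D (j + 1) t) t u)
    (hκ : ∀ t ∈ Metric.ball t₀ (4 * r), κ ≤ |D N t|) {η : ℝ} (hη : 0 < η)
    (hη' : 2 ^ N * η ^ (N + 1) < κ) :
    ENNReal.ofReal (2 * r) * μ {t ∈ Metric.ball t₀ r | |D 0 t| ≤ η ^ (2 * N + 1)} ≤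
      ENNReal.ofReal (2 * 2 ^ N * η) * μ (Metric.ball t₀ (2 * r)) := by
  set A := {t ∈ Metric.ball t₀ r | |D 0 t| ≤ η ^ (2 * N + 1)} with hAdef
  have hA : MeasurableSet A := by
    have hc' : ContinuousOn (fun t => |D 0 t|) (Metric.ball t₀ r) :=
      (hc.mono (Metric.ball_subset_ball (by linarith))).abs
    have h1 := hc'.isOpen_inter_preimage Metric.isOpen_ball (isOpen_Ioi (a := η ^ (2 * N + 1)))
    have h2 : A = Metric.ball t₀ r \
        (Metric.ball t₀ r ∩ (fun t => |D 0 t|) ⁻¹' Ioi (η ^ (2 * N + 1))) := by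
      ext t
      simp only [hAdef, mem_ofPred_eq, Set.mem_sdiff, mem_inter_iff, mem_preimage, mem_Ioi, not_and,
        not_lt]
      tauto
    rw [h2]
    exact Metric.isOpen_ball.measurableSet.diff h1.measurableSet
  have hmeas : Measurable (Function.uncurry fun (t : E) (s : ℝ) =>
      A.indicator (fun _ => (1 : ℝ≥0∞)) (t + s • u)) :=
    (measurable_const.indicator hA).comp (by fun_prop)
  have hseg : ∀ t ∈ Metric.ball t₀ (2 * r), ∀ s ∈ Icc (-r) r, t + s • u ∈ Metric.ball t₀ (4 * r) := by
    intro t ht s hs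
    rw [Metric.mem_ball, dist_eq_norm] at ht ⊢
    have h1 : ‖s • u‖ ≤ r := by
      rw [norm_smul, Real.norm_eq_abs]
      calc |s| * ‖u‖ ≤ r * 1 := by gcongr; exact abs_le.2 hs
        _ = r := mul_one r
    calc ‖t + s • u - t₀‖ = ‖(t - t₀) + s • u‖ := by congr 1; abel
      _ ≤ ‖t - t₀‖ + ‖s • u‖ := norm_add_le _ _
      _ < 4 * r := by linarith
  have hinner : ∀ t, ∫⁻ s : ℝ in Icc (-r) r, A.indicator (fun _ => (1 : ℝ≥0∞)) (t + s • u) ≤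
      (Metric.ball t₀ (2 * r)).indicator (fun _ => ENNReal.ofReal (2 * 2 ^ N * η)) t := by
    intro t
    by_cases ht : t ∈ Metric.ball t₀ (2 * r)
    · rw [indicator_of_mem ht]
      have h1 : ∫⁻ s : ℝ in Icc (-r) r, A.indicator (fun _ => (1 : ℝ≥0∞)) (t + s • u) =
          volume ({s | t + s • u ∈ A} ∩ Icc (-r) r) := by
        have : (fun s : ℝ => A.indicator (fun _ => (1 : ℝ≥0∞)) (t + s • u)) =
            {s : ℝ | t + s • u ∈ A}.indicator 1 := by
          ext s; simp [indicator]
        have hm : MeasurableSet {s : ℝ | t + s • u ∈ A} :=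
          hA.preimage (f := fun s : ℝ => t + s • u) (by fun_prop)
        rw [this, lintegral_indicator_one hm, Measure.restrict_apply hm]
      rw [h1]
      refine le_trans (measure_mono ?_) (volume_sublevel_interval_le (-r) r κ N
        (fun j s => D j (t + s • u)) ?_ ?_ hη hη')
      · rintro s ⟨hs, hs'⟩
        exact ⟨hs', hs.2⟩
      · intro j s hs
        have h2 := hD j _ (hseg t ht s hs)
        have h3 : HasDerivAt (fun τ : ℝ => D j (t + s • u + τ • u)) (D (j + 1) (t + s • u)) (s - s) := by
          rw [sub_self]; exact h2
        have h4 := h3.comp_sub_const s s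
        refine h4.congr_of_eventuallyEq (Filter.Eventually.of_forall fun τ => ?_)
        simp only [sub_smul]
        congr 1; abel
      · exact fun s hs => hκ _ (hseg t ht s hs)
    · rw [indicator_of_notMem ht, nonpos_iff_eq_zero]
      refine (setLIntegral_congr_fun (g := fun _ => 0) measurableSet_Icc ?_).trans (by simp)
      · intro (s : ℝ) hs
        refine indicator_of_notMem (fun hmem => ht ?_) _
        have h0 := hmem.1
        rw [Metric.mem_ball, dist_eq_norm] at h0 ⊢
        have h1 : ‖s • u‖ ≤ r := by
          rw [norm_smul, Real.norm_eq_abs]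
          calc |s| * ‖u‖ ≤ r * 1 := by gcongr; exact abs_le.2 hs
            _ = r := mul_one r
        calc ‖t - t₀‖ = ‖(t + s • u - t₀) - s • u‖ := by congr 1; abel
          _ ≤ ‖t + s • u - t₀‖ + ‖s • u‖ := norm_sub_le _ _
          _ < 2 * r := by linarith
  calc ENNReal.ofReal (2 * r) * μ A
      = ∫⁻ s : ℝ in Icc (-r) r, ∫⁻ t, A.indicator (fun _ => (1 : ℝ≥0∞)) (t + s • u) ∂μ := by
        have : ∀ s : ℝ, ∫⁻ t, A.indicator (fun _ => (1 : ℝ≥0∞)) (t + s • u) ∂μ = μ A := by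
          intro s
          rw [lintegral_add_right_eq_self (fun t => A.indicator (fun _ => (1 : ℝ≥0∞)) t)]
          exact lintegral_indicator_one hA
        simp only [this, setLIntegral_const, Real.volume_Icc]
        rw [mul_comm]; congr 2; ring
    _ = ∫⁻ t, (∫⁻ s : ℝ in Icc (-r) r, A.indicator (fun _ => (1 : ℝ≥0∞)) (t + s • u)) ∂μ :=
        (lintegral_lintegral_swap hmeas.aemeasurable).symm
    _ ≤ ∫⁻ t, (Metric.ball t₀ (2 * r)).indicator (fun _ => ENNReal.ofReal (2 * 2 ^ N * η)) t ∂μ :=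
        lintegral_mono hinner
    _ = _ := by rw [lintegral_indicator_const Metric.isOpen_ball.measurableSet]

/-- An analytic function which does not vanish identically near `t₀` has a nonzero iterated
directional derivative at `t₀`, in a fixed direction. -/
theorem AnalyticOnNhd.exists_iterate_fderiv_ne_zero {E : Type*} [NormedAddCommGroup E]
    [NormedSpace ℝ E] {f : E → ℝ} {t₀ : E} {R : ℝ} (hR : 0 < R)
    (hf : AnalyticOnNhd ℝ f (Metric.ball t₀ R)) (hne : ¬ ∀ᶠ t in 𝓝 t₀, f t = 0) :
    ∃ u : E, ‖u‖ ≤ 1 ∧ ∃ N : ℕ, (fun h : E → ℝ => fun t => fderiv ℝ h t u)^[N] f t₀ ≠ 0 := by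
  obtain ⟨t₁, ht₁, hft₁⟩ : ∃ t ∈ Metric.ball t₀ (min R 1), f t ≠ 0 := by
    by_contra! hcon
    exact hne (Filter.eventually_of_mem (Metric.ball_mem_nhds t₀ (by positivity)) hcon)
  have hn : ‖t₁ - t₀‖ < min R 1 := by rwa [Metric.mem_ball, dist_eq_norm] at ht₁
  refine ⟨t₁ - t₀, (hn.le.trans (min_le_right _ _)), ?_⟩
  set u := t₁ - t₀ with hu
  by_contra! hz
  set T : (E → ℝ) → E → ℝ := fun h t => fderiv ℝ h t u with hT
  set line : ℝ → E := fun s => t₀ + s • u with hline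
  have hlineA : ∀ s, AnalyticAt ℝ line s := fun s => by
    have : AnalyticAt ℝ (fun s : ℝ => s • u) s := analyticAt_id.smul analyticAt_const
    exact analyticAt_const.add this
  have hlined : ∀ s, HasDerivAt line u s := fun s => by
    have := ((hasDerivAt_id s).smul_const u).const_add t₀
    rwa [one_smul] at this
  set O : Set ℝ := line ⁻¹' Metric.ball t₀ R with hO
  have hOopen : IsOpen O := Metric.isOpen_ball.preimage
    (continuous_iff_continuousAt.2 fun s => (hlineA s).continuousAt)
  have hOconv : Convex ℝ O := by
    have hl : line = (AffineMap.lineMap t₀ t₁ : ℝ →ᵃ[ℝ] E) := by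
      ext s
      simp [hline, AffineMap.lineMap_apply, hu, add_comm]
    rw [hO, hl]
    exact (convex_ball t₀ R).affine_preimage (AffineMap.lineMap t₀ t₁ : ℝ →ᵃ[ℝ] E)
  have h0 : (0 : ℝ) ∈ O := by simp [hO, hline, hR]
  have h1 : (1 : ℝ) ∈ O := by
    simp only [hO, hline, mem_preimage, one_smul, Metric.mem_ball, dist_eq_norm, add_sub_cancel_left]
    exact hn.trans_le (min_le_left _ _)
  have hTan : ∀ j, AnalyticOnNhd ℝ (T^[j] f) (Metric.ball t₀ R) := by
    intro j
    induction j with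
    | zero => exact hf
    | succ j ih =>
      rw [Function.iterate_succ_apply']
      intro t ht
      exact (ContinuousLinearMap.analyticAt (ContinuousLinearMap.apply ℝ ℝ u) _).comp
        (ih.fderiv t ht)
  have hiter : ∀ j, ∀ s ∈ O, iteratedDeriv j (fun s => f (line s)) s = (T^[j] f) (line s) := by
    intro j
    induction j with
    | zero => intro s _; simp
    | succ j ih =>
      intro s hs
      rw [iteratedDeriv_succ, Function.iterate_succ_apply']
      have hev : iteratedDeriv j (fun s => f (line s)) =ᶠ[𝓝 s] fun s => (T^[j] f) (line s) :=
        Filter.eventually_of_mem (hOopen.mem_nhds hs) ih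
      rw [hev.deriv_eq]
      exact (((hTan j _ hs).differentiableAt.hasFDerivAt).comp_hasDerivAt s (hlined s)).deriv
  have hg : AnalyticOnNhd ℝ (fun s => f (line s)) O := fun s hs => (hf _ hs).comp (hlineA s)
  have hser := (hg 0 h0).hasFPowerSeriesAt
  have hzero : ∀ᶠ s in 𝓝 (0 : ℝ), f (line s) = 0 := by
    have hp : (FormalMultilinearSeries.ofScalars ℝ
        (fun n => iteratedDeriv n (fun s => f (line s)) 0 / n.factorial)) =
        (0 : FormalMultilinearSeries ℝ ℝ ℝ) := by
      have hl0 : line 0 = t₀ := by simp [hline]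
      have hz' : ∀ n, iteratedDeriv n (fun s => f (line s)) 0 = 0 := fun n => by
        rw [hiter n 0 h0, hl0]; exact hz n
      ext n
      simp [FormalMultilinearSeries.ofScalars, hz']
    rw [hp] at hser
    exact hser.eventually_eq_zero
  have := hg.eqOn_zero_of_preconnected_of_eventuallyEq_zero hOconv.isPreconnected h0 hzero h1
  apply hft₁
  simpa [hline, hu] using this

/-- Sublevel sets of an analytic function which is not identically zero near a point have measure
decaying like a power of the level. -/
theorem AnalyticAt.exists_volume_sublevel_le {E : Type*} [NormedAddCommGroup E] [NormedSpace ℝ E]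
    [FiniteDimensional ℝ E] [MeasurableSpace E] [BorelSpace E] (μ : Measure E) [μ.IsAddHaarMeasure]
    {f : E → ℝ} {t₀ : E} (hf : AnalyticAt ℝ f t₀) (hne : ¬ ∀ᶠ t in 𝓝 t₀, f t = 0) :
    ∃ r > 0, ∃ γ : ℝ, 0 < γ ∧ γ ≤ 1 ∧ ∃ C : ℝ, 0 ≤ C ∧ ∀ ε : ℝ, 0 < ε → ε ≤ 1 →
      μ {t ∈ Metric.ball t₀ r | |f t| ≤ ε} ≤ ENNReal.ofReal (C * ε ^ γ) := by
  obtain ⟨R, hR, hfR⟩ : ∃ R > 0, AnalyticOnNhd ℝ f (Metric.ball t₀ R) := by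
    obtain ⟨R, hR, h⟩ := Metric.eventually_nhds_iff_ball.1 hf.eventually_analyticAt
    exact ⟨R, hR, h⟩
  obtain ⟨u, hu, N, hN⟩ := hfR.exists_iterate_fderiv_ne_zero hR hne
  set T : (E → ℝ) → E → ℝ := fun h t => fderiv ℝ h t u with hT
  have hTan : ∀ j, AnalyticOnNhd ℝ (T^[j] f) (Metric.ball t₀ R) := by
    intro j
    induction j with
    | zero => exact hfR
    | succ j ih =>
      rw [Function.iterate_succ_apply']
      intro t ht
      exact (ContinuousLinearMap.analyticAt (ContinuousLinearMap.apply ℝ ℝ u) _).comp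
        (ih.fderiv t ht)
  set κ := |(T^[N] f) t₀| / 2 with hκdef
  have hκ : 0 < κ := by have := abs_pos.2 hN; positivity
  obtain ⟨ρ, hρ, hρκ⟩ : ∃ ρ > 0, ∀ t ∈ Metric.ball t₀ ρ, κ ≤ |(T^[N] f) t| := by
    have hc : ContinuousAt (fun t => |(T^[N] f) t|) t₀ :=
      (hTan N t₀ (Metric.mem_ball_self hR)).continuousAt.abs
    have := hc.eventually (lt_mem_nhds (show κ < |(T^[N] f) t₀| by rw [hκdef] at *; linarith))
    obtain ⟨ρ, hρ, h⟩ := Metric.eventually_nhds_iff_ball.1 this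
    exact ⟨ρ, hρ, fun t ht => (h t ht).le⟩
  set r := min R ρ / 4 with hr
  have hr0 : 0 < r := by positivity
  have h4R : Metric.ball t₀ (4 * r) ⊆ Metric.ball t₀ R :=
    Metric.ball_subset_ball (by rw [hr]; linarith [min_le_left R ρ])
  have h4ρ : Metric.ball t₀ (4 * r) ⊆ Metric.ball t₀ ρ :=
    Metric.ball_subset_ball (by rw [hr]; linarith [min_le_right R ρ])
  set B := (μ (Metric.ball t₀ (2 * r))).toReal with hB
  have hBtop : μ (Metric.ball t₀ (2 * r)) = ENNReal.ofReal B :=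
    (ENNReal.ofReal_toReal measure_ball_lt_top.ne).symm
  have hB0 : 0 ≤ B := ENNReal.toReal_nonneg
  -- the threshold below which the sublevel estimate on segments applies
  obtain ⟨η₀, hη₀, hη₁⟩ : ∃ η₀ > 0, ∀ η : ℝ, 0 < η → η < η₀ → 2 ^ N * η ^ (N + 1) < κ := by
    have hc : ContinuousAt (fun η : ℝ => 2 ^ N * η ^ (N + 1)) 0 := by fun_prop
    have := hc.eventually (gt_mem_nhds (show _ < κ by simpa using hκ))
    obtain ⟨η₀, hη₀, h⟩ := Metric.eventually_nhds_iff_ball.1 this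
    exact ⟨η₀, hη₀, fun η h1 h2 => h η (by simpa [abs_of_pos h1] using h2)⟩
  refine ⟨r, hr0, (1 / (2 * N + 1) : ℝ), by positivity, ?_, 2 ^ N * B / r + B / η₀, by positivity, ?_⟩
  · rw [div_le_one (by positivity)]; linarith [(Nat.cast_nonneg N : (0 : ℝ) ≤ N)]
  intro ε hε hε1
  set η := ε ^ (1 / (2 * N + 1) : ℝ) with hηdef
  have hη : 0 < η := by positivity
  have hηpow : η ^ (2 * N + 1) = ε := by
    rw [hηdef, ← Real.rpow_natCast, ← Real.rpow_mul hε.le]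
    push_cast
    rw [one_div, inv_mul_cancel₀ (by positivity), Real.rpow_one]
  rcases lt_or_ge η η₀ with hlt | hge
  · have key := volume_sublevel_ball_le μ hr0 hu N (fun j => T^[j] f) (hfR.continuousOn.mono h4R)
      (fun j t ht => by
        have := (hTan j t (h4R ht)).differentiableAt.hasFDerivAt.hasLineDerivAt u
        simpa only [Function.iterate_succ_apply'] using this)
      (fun t ht => hρκ t (h4ρ ht)) hη (hη₁ η hη hlt)
    rw [hηpow, hBtop, ← ENNReal.ofReal_mul (by positivity)] at key
    simp only [Function.iterate_zero, id_eq] at key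
    have h2r : ENNReal.ofReal (2 * r) ≠ 0 := by simpa using hr0
    calc μ {t ∈ Metric.ball t₀ r | |f t| ≤ ε}
        ≤ ENNReal.ofReal (2 * 2 ^ N * η * B) / ENNReal.ofReal (2 * r) := by
          rw [ENNReal.le_div_iff_mul_le (Or.inl h2r) (Or.inl ENNReal.ofReal_ne_top), mul_comm]
          exact key
      _ = ENNReal.ofReal (2 * 2 ^ N * η * B / (2 * r)) := by
          rw [ENNReal.ofReal_div_of_pos (by positivity)]
      _ ≤ _ := by
          apply ENNReal.ofReal_le_ofReal
          have : 0 ≤ B / η₀ * η := by positivity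
          have h3 : 2 * 2 ^ N * η * B / (2 * r) = 2 ^ N * B / r * η := by field_simp
          rw [h3, add_mul]; linarith
  · calc μ {t ∈ Metric.ball t₀ r | |f t| ≤ ε} ≤ μ (Metric.ball t₀ (2 * r)) :=
          measure_mono fun t ht => Metric.ball_subset_ball (by linarith) ht.1
      _ = ENNReal.ofReal B := hBtop
      _ ≤ _ := by
          apply ENNReal.ofReal_le_ofReal
          have h3 : B ≤ B / η₀ * η := by
            rw [div_mul_eq_mul_div, le_div_iff₀ hη₀]; gcongr
          have : 0 ≤ 2 ^ N * B / r * η := by positivity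
          rw [add_mul]; linarith

/-! ### The area formula for immersions -/

/-- If `f` is `K`-Lipschitz on `E` as measured by `g`, the Euclidean Hausdorff measure of `f '' E` is at most
`K ^ m` times that of `g '' E`. -/
theorem euclideanHausdorffMeasure_image_le_of_dist_le {X Y Z : Type*}
    [MetricSpace Y] [MeasurableSpace Y] [BorelSpace Y]
    [MetricSpace Z] [MeasurableSpace Z] [BorelSpace Z]
    (m : ℕ) {f : X → Y} {g : X → Z} {E : Set X} {K : ℝ≥0}
    (h : ∀ x ∈ E, ∀ y ∈ E, dist (f x) (f y) ≤ K * dist (g x) (g y)) :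
    μHE[m] (f '' E) ≤ (K : ℝ≥0∞) ^ m * μHE[m] (g '' E) := by
  rcases E.eq_empty_or_nonempty with rfl | ⟨x₀, hx₀⟩
  · simp
  have : Nonempty X := ⟨x₀⟩
  set ψ : Z → X := Function.invFunOn g E with hψ
  have hmem : ∀ x ∈ E, ψ (g x) ∈ E := fun x hx => Function.invFunOn_mem ⟨x, hx, rfl⟩
  have heq : ∀ x ∈ E, g (ψ (g x)) = g x := fun x hx => Function.invFunOn_eq ⟨x, hx, rfl⟩
  have himg : f '' E = (f ∘ ψ) '' (g '' E) := by
    rw [image_image]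
    refine image_congr fun x hx => ?_
    have h1 := h x hx _ (hmem x hx)
    rw [heq x hx, dist_self, mul_zero] at h1
    exact dist_le_zero.1 h1
  have hlip : LipschitzOnWith K (f ∘ ψ) (g '' E) := by
    refine LipschitzOnWith.of_dist_le_mul ?_
    rintro _ ⟨x, hx, rfl⟩ _ ⟨y, hy, rfl⟩
    have h1 := h _ (hmem x hx) _ (hmem y hy)
    rwa [heq x hx, heq y hy] at h1
  have h2 := hlip.hausdorffMeasure_image_le (d := (m : ℝ)) (Nat.cast_nonneg m)
  rw [himg]
  simp only [Measure.euclideanHausdorffMeasure_def, Measure.smul_apply]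
  calc _ ≤ volume.addHaarScalarFactor (μH[(m : ℝ)] : Measure (EuclideanSpace ℝ (Fin m))) •
        ((K : ℝ≥0∞) ^ (m : ℝ) * μH[(m : ℝ)] (g '' E)) := by
        rw [ENNReal.smul_def, ENNReal.smul_def, smul_eq_mul, smul_eq_mul]
        gcongr
    _ = _ := by
        rw [ENNReal.smul_def, ENNReal.smul_def, smul_eq_mul, smul_eq_mul, ENNReal.rpow_natCast]
        ring

/-- The `m`-dimensional Jacobian of a map `φ : ℝᵐ → ℝᵈ`. -/
noncomputable def volumeJacobian {m d : ℕ} (φ : Eucl m → Eucl d) (t : Eucl m) : ℝ :=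
  (fderiv ℝ φ t : Eucl m →ₗ[ℝ] Eucl d).normDet

/-- The image under the linear part `A` of an immersion has, near the base point and up to factors
`K ^ m` with `K > 1` arbitrary, the same Hausdorff measure as the image under the immersion. -/
theorem eventually_euclideanHausdorffMeasure_image_closedBall {m d : ℕ} {φ : Eucl m → Eucl d}
    {A : Eucl m →L[ℝ] Eucl d} {t : Eucl m} (hφ : HasStrictFDerivAt φ A t)
    (hA : Function.Injective A) {K : ℝ≥0} (hK : 1 < K) :
    ∀ᶠ r in 𝓝[>] (0 : ℝ),
      μHE[m] (φ '' Metric.closedBall t r) ≤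
        (K : ℝ≥0∞) ^ m * (ENNReal.ofReal (A : Eucl m →ₗ[ℝ] Eucl d).normDet *
          volume (Metric.closedBall t r)) ∧
      ENNReal.ofReal (A : Eucl m →ₗ[ℝ] Eucl d).normDet * volume (Metric.closedBall t r) ≤
        (K : ℝ≥0∞) ^ m * μHE[m] (φ '' Metric.closedBall t r) := by
  obtain ⟨κ, hκ, hκA⟩ := (A : Eucl m →ₗ[ℝ] Eucl d).exists_antilipschitzWith
    (LinearMap.ker_eq_bot.2 hA)
  have hK' : (1 : ℝ) < K := by exact_mod_cast hK
  have hκ' : (0 : ℝ) < κ := by exact_mod_cast hκ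
  -- with this error, `φ` and `A` have comparable increments up to the factor `K`
  set c : ℝ := (K - 1) / (K * κ) with hc
  have hc0 : 0 < c := div_pos (by linarith) (by positivity)
  have hcκ : c * κ = (K - 1) / K := by rw [hc]; field_simp
  obtain ⟨s, hs, happ⟩ := hφ.approximates_deriv_on_nhds (c := c.toNNReal)
    (Or.inr (by simpa using hc0))
  have hbound : ∀ x ∈ s, ∀ y ∈ s, ‖φ x - φ y - (A x - A y)‖ ≤ (K - 1) / K * ‖A x - A y‖ := by
    intro x hx y hy
    have h1 := happ x hx y hy
    rw [map_sub, Real.coe_toNNReal _ hc0.le] at h1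
    have h2 : ‖x - y‖ ≤ κ * ‖A x - A y‖ := by
      have := hκA.le_mul_dist x y
      simpa [dist_eq_norm] using this
    calc _ ≤ c * ‖x - y‖ := h1
      _ ≤ c * (κ * ‖A x - A y‖) := by gcongr
      _ = _ := by rw [← mul_assoc, hcκ]
  have hvol : ∀ r, μHE[m] (A '' Metric.closedBall t r) =
      ENNReal.ofReal (A : Eucl m →ₗ[ℝ] Eucl d).normDet * volume (Metric.closedBall t r) := by
    intro r
    have := (A : Eucl m →ₗ[ℝ] Eucl d).euclideanHausdorffMeasure_image_eq_normDet_mul_volume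
      (Metric.closedBall t r)
    simpa using this
  obtain ⟨r₀, hr₀, hball⟩ := Metric.nhds_basis_closedBall.mem_iff.1 hs
  have hmem : ∀ᶠ r in 𝓝[>] (0 : ℝ), r ∈ Ioc (0 : ℝ) r₀ := Ioc_mem_nhdsGT hr₀
  filter_upwards [hmem] with r hr
  have hsub : Metric.closedBall t r ⊆ s := (Metric.closedBall_subset_closedBall hr.2).trans hball
  rw [← hvol]
  have hKK : (K - 1 : ℝ) / K ≤ K - 1 := by
    rw [div_le_iff₀ (by positivity)]; nlinarith
  constructor
  · refine euclideanHausdorffMeasure_image_le_of_dist_le m fun x hx y hy => ?_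
    rw [dist_eq_norm, dist_eq_norm]
    have h1 := hbound x (hsub hx) y (hsub hy)
    have h2 : ‖φ x - φ y‖ ≤ ‖φ x - φ y - (A x - A y)‖ + ‖A x - A y‖ := by
      simpa using norm_add_le (φ x - φ y - (A x - A y)) (A x - A y)
    nlinarith [norm_nonneg (A x - A y)]
  · refine euclideanHausdorffMeasure_image_le_of_dist_le m fun x hx y hy => ?_
    rw [dist_eq_norm, dist_eq_norm]
    have h1 := hbound x (hsub hx) y (hsub hy)
    have h2 : ‖A x - A y‖ ≤ ‖φ x - φ y‖ + ‖φ x - φ y - (A x - A y)‖ := by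
      simpa using norm_sub_le (φ x - φ y) (φ x - φ y - (A x - A y))
    have h3 : (1 / K : ℝ) * ‖A x - A y‖ ≤ ‖φ x - φ y‖ := by
      have : (1 / K : ℝ) = 1 - (K - 1) / K := by field_simp; ring
      rw [this]; linarith
    rw [div_mul_eq_mul_div, one_mul, div_le_iff₀ (by positivity)] at h3
    linarith

/-- Area formula for an injective Lipschitz immersion of an open set. -/
theorem comap_euclideanHausdorffMeasure_eq {m d : ℕ} {φ : Eucl m → Eucl d} {B : Set (Eucl m)}
    (hB : IsOpen B) (hφ : ContDiffOn ℝ 1 φ B) (himm : ∀ t ∈ B, Function.Injective (fderiv ℝ φ t))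
    (hinj : InjOn φ B) {L : ℝ≥0} (hL : LipschitzOnWith L φ B) :
    Measure.comap (B.domRestrict φ) μHE[m] =
      Measure.comap Subtype.val
        ((volume : Measure (Eucl m)).withDensity fun t => ENNReal.ofReal (volumeJacobian φ t)) := by
  have hemb : MeasurableEmbedding (B.domRestrict φ) :=
    hφ.continuousOn.measurableEmbedding hB.measurableSet hinj
  have hval : MeasurableEmbedding (Subtype.val : B → Eucl m) :=
    MeasurableEmbedding.subtype_coe hB.measurableSet
  set ρ : Measure (Eucl m) := Measure.map Subtype.val (Measure.comap (B.domRestrict φ) μHE[m])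
    with hρ
  have hρapp : ∀ E, ρ E = μHE[m] (φ '' (E ∩ B)) := by
    intro E
    rw [hρ, hval.map_apply, hemb.comap_apply]
    congr 1
    ext y
    simp only [mem_image, mem_preimage, Subtype.exists, Set.domRestrict_apply, mem_inter_iff]
    grind
  have hle : ∀ E, ρ E ≤ (L : ℝ≥0∞) ^ m * volume E := by
    intro E
    rw [hρapp]
    have h1 := euclideanHausdorffMeasure_image_le_of_dist_le (f := φ) (g := id) (E := E ∩ B) (K := L) m
      (fun x hx y hy => hL.dist_le_mul x hx.2 y hy.2)
    rw [image_id, EuclideanSpace.euclideanHausdorffMeasure_eq_volume] at h1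
    exact h1.trans (by gcongr; exact inter_subset_left)
  have hac : ρ ≪ volume := by
    refine Measure.AbsolutelyContinuous.mk fun E _ hE => ?_
    have := hle E
    rwa [hE, mul_zero, nonpos_iff_eq_zero] at this
  have : IsLocallyFiniteMeasure ρ := by
    refine ⟨fun x => ⟨Metric.ball x 1, Metric.ball_mem_nhds x one_pos, ?_⟩⟩
    refine (hle _).trans_lt (ENNReal.mul_lt_top ?_ measure_ball_lt_top)
    exact ENNReal.pow_lt_top ENNReal.coe_lt_top
  have hdens : ∀ᵐ t ∂(volume : Measure (Eucl m)), t ∈ B →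
      ρ.rnDeriv volume t = ENNReal.ofReal (volumeJacobian φ t) := by
    filter_upwards [Besicovitch.ae_tendsto_rnDeriv ρ volume] with t ht htB
    have hstrict : HasStrictFDerivAt φ (fderiv ℝ φ t) t :=
      (hφ.contDiffAt (hB.mem_nhds htB)).hasStrictFDerivAt one_ne_zero
    set J := ENNReal.ofReal (volumeJacobian φ t) with hJ
    have hJtop : J ≠ (⊤ : ℝ≥0∞) := ENNReal.ofReal_ne_top
    have hsmall : ∀ᶠ r in 𝓝[>] (0 : ℝ), 0 < r ∧ Metric.closedBall t r ⊆ B := by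
      obtain ⟨r₀, hr₀, hball⟩ := Metric.nhds_basis_closedBall.mem_iff.1 (hB.mem_nhds htB)
      filter_upwards [Ioc_mem_nhdsGT hr₀] with r hr
      exact ⟨hr.1, (Metric.closedBall_subset_closedBall hr.2).trans hball⟩
    have hcmp : ∀ K : ℝ≥0, 1 < K →
        ρ.rnDeriv volume t ≤ (K : ℝ≥0∞) ^ m * J ∧ J ≤ (K : ℝ≥0∞) ^ m * ρ.rnDeriv volume t := by
      intro K hK
      have hev := eventually_euclideanHausdorffMeasure_image_closedBall hstrict (himm t htB) hK
      have hKm : (K : ℝ≥0∞) ^ m ≠ (⊤ : ℝ≥0∞) := (ENNReal.pow_lt_top ENNReal.coe_lt_top).ne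
      constructor
      · refine le_of_tendsto ht ?_
        filter_upwards [hev, hsmall] with r h1 h2
        have hpos : volume (Metric.closedBall t r) ≠ 0 :=
          (Metric.measure_closedBall_pos volume t h2.1).ne'
        rw [ENNReal.div_le_iff hpos measure_closedBall_lt_top.ne, hρapp,
          inter_eq_self_of_subset_left h2.2, mul_assoc]
        exact h1.1
      · refine ge_of_tendsto (ENNReal.Tendsto.const_mul ht (Or.inr hKm)) ?_
        filter_upwards [hev, hsmall] with r h1 h2
        have hpos : volume (Metric.closedBall t r) ≠ 0 :=
          (Metric.measure_closedBall_pos volume t h2.1).ne'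
        rw [← mul_div_assoc, ENNReal.le_div_iff_mul_le (Or.inl hpos)
          (Or.inl measure_closedBall_lt_top.ne), hρapp, inter_eq_self_of_subset_left h2.2]
        exact h1.2
    have hlim : ∀ a : ℝ≥0∞, Filter.Tendsto (fun K : ℝ≥0 => (K : ℝ≥0∞) ^ m * a) (𝓝[>] 1) (𝓝 a) := by
      intro a
      have h1 : Filter.Tendsto (fun K : ℝ≥0 => (K : ℝ≥0∞) ^ m) (𝓝[>] 1) (𝓝 1) := by
        have : Filter.Tendsto (fun K : ℝ≥0 => ((K ^ m : ℝ≥0) : ℝ≥0∞)) (𝓝 1) (𝓝 ((1 ^ m : ℝ≥0))) :=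
          ENNReal.tendsto_coe.2 ((continuous_pow m).tendsto 1)
        simpa using this.mono_left nhdsWithin_le_nhds
      simpa using ENNReal.Tendsto.mul_const h1 (Or.inl one_ne_zero) (b := a)
    refine le_antisymm (ge_of_tendsto (hlim J) ?_) (ge_of_tendsto (hlim _) ?_)
    · filter_upwards [self_mem_nhdsWithin] with K hK using (hcmp K hK).1
    · filter_upwards [self_mem_nhdsWithin] with K hK using (hcmp K hK).2
  ext E hE
  have hEB : (Subtype.val '' E : Set (Eucl m)) ⊆ B := by
    rintro _ ⟨x, _, rfl⟩; exact x.2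
  have hEm : MeasurableSet (Subtype.val '' E : Set (Eucl m)) := hval.measurableSet_image.2 hE
  have h1 : Measure.comap (B.domRestrict φ) μHE[m] E = ρ (Subtype.val '' E) := by
    rw [hρ, hval.map_apply, preimage_image_eq _ Subtype.val_injective]
  rw [h1, hval.comap_apply, withDensity_apply _ hEm, ← Measure.withDensity_rnDeriv_eq ρ volume hac,
    withDensity_apply _ hEm]
  refine setLIntegral_congr_fun_ae hEm ?_
  filter_upwards [hdens] with t ht htE using ht (hEB htE)

/-- The Jacobian of a smooth immersion is smooth: its square is a determinant. -/
theorem contDiffOn_volumeJacobian {m d : ℕ} {φ : Eucl m → Eucl d} {B : Set (Eucl m)}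
    (hB : IsOpen B) (hφ : ContDiffOn ℝ ∞ φ B) (himm : ∀ t ∈ B, Function.Injective (fderiv ℝ φ t)) :
    ContDiffOn ℝ ∞ (volumeJacobian φ) B := by
  have hfd : ContDiffOn ℝ ∞ (fderiv ℝ φ) B := hφ.fderiv_of_isOpen hB (by simp)
  have hsq : ∀ t, (volumeJacobian φ t) ^ 2 =
      (Matrix.of fun i j : Fin m => inner ℝ (fderiv ℝ φ t (EuclideanSpace.single i 1))
        (fderiv ℝ φ t (EuclideanSpace.single j 1))).det := by
    intro t
    have := (fderiv ℝ φ t : Eucl m →ₗ[ℝ] Eucl d).normDet_sq_eq_det_gram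
      (EuclideanSpace.basisFun (Fin m) ℝ)
    simp only [RCLike.ofReal_real_eq_id, id_eq] at this
    rw [volumeJacobian, this]
    congr 1
    ext i j
    simp [Matrix.gram]
  have hdet : ContDiffOn ℝ ∞ (fun t => (volumeJacobian φ t) ^ 2) B := by
    simp only [hsq, Matrix.det_apply]
    refine ContDiffOn.sum fun σ _ => ContDiffOn.const_smul _ (contDiffOn_prod fun i _ => ?_)
    exact (hfd.clm_apply contDiffOn_const).inner ℝ (hfd.clm_apply contDiffOn_const)
  have hne : ∀ t ∈ B, (volumeJacobian φ t) ^ 2 ≠ 0 := by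
    intro t ht h
    have h0 : volumeJacobian φ t = 0 := by simpa using h
    exact (LinearMap.normDet_eq_zero_iff_ker_ne_bot.1 h0) (LinearMap.ker_eq_bot.2 (himm t ht))
  refine (hdet.sqrt hne).congr fun t _ => ?_
  exact (Real.sqrt_sq (LinearMap.normDet_nonneg _)).symm

/-- Integration in a chart, against a measure with a density with respect to the volume measure
of `S`. -/
theorem setIntegral_withDensity_euclideanHausdorffMeasure {m d : ℕ} {φ : Eucl m → Eucl d}
    {B : Set (Eucl m)} (hB : IsOpen B) (hφ : ContDiffOn ℝ ∞ φ B)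
    (himm : ∀ t ∈ B, Function.Injective (fderiv ℝ φ t))
    (hinj : InjOn φ B) {L : ℝ≥0} (hL : LipschitzOnWith L φ B) {S U : Set (Eucl d)}
    (hU : MeasurableSet U) (hSU : S ∩ U = φ '' B) {g : Eucl d → ℝ} (hg : ContinuousOn (g ∘ φ) B)
    (hg0 : ∀ x ∈ S, 0 ≤ g x) (F : Eucl d → ℂ) :
    ∫ x in U, F x ∂(((μHE[m] : Measure (Eucl d)).restrict S).withDensity
        fun x => ENNReal.ofReal (g x)) =
      ∫ t in B, (g (φ t) * volumeJacobian φ t) • F (φ t) := by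
  have hemb : MeasurableEmbedding (B.domRestrict φ) :=
    hφ.continuousOn.measurableEmbedding hB.measurableSet hinj
  have hrange : range (B.domRestrict φ) = S ∩ U := by rw [hSU, range_domRestrict]
  have hgm : AEMeasurable ((fun x => ENNReal.ofReal (g x)) ∘ B.domRestrict φ)
      (Measure.comap (B.domRestrict φ) μHE[m]) :=
    (ENNReal.continuous_ofReal.comp
      (continuousOn_iff_continuous_domRestrict.1 hg)).measurable.aemeasurable
  rw [restrict_withDensity hU, Measure.restrict_restrict hU, inter_comm, ← hrange,
    ← hemb.map_comap, integral_withDensity_eq_integral_toReal_smul₀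
      (hemb.aemeasurable_map_iff.2 hgm) (Filter.Eventually.of_forall fun _ => ENNReal.ofReal_lt_top),
    hemb.integral_map,
    comap_euclideanHausdorffMeasure_eq hB (hφ.of_le (by exact_mod_cast le_top)) himm hinj hL]
  have hJ : AEMeasurable (fun t => ENNReal.ofReal (volumeJacobian φ t)) (volume.restrict B) :=
    (ENNReal.continuous_ofReal.comp_continuousOn
      (contDiffOn_volumeJacobian hB hφ himm).continuousOn).aemeasurable hB.measurableSet
  have h1 := integral_subtype_comap (μ := (volume : Measure (Eucl m)).withDensity
    fun t => ENNReal.ofReal (volumeJacobian φ t)) hB.measurableSet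
    (fun t => (ENNReal.ofReal (g (φ t))).toReal • F (φ t))
  refine h1.trans ?_
  rw [restrict_withDensity hB.measurableSet, integral_withDensity_eq_integral_toReal_smul₀ hJ
    (Filter.Eventually.of_forall fun _ => ENNReal.ofReal_lt_top)]
  refine setIntegral_congr_fun hB.measurableSet fun t ht => ?_
  have hS : φ t ∈ S := (hSU.ge (mem_image_of_mem φ ht)).1
  have hJ0 : 0 ≤ volumeJacobian φ t := LinearMap.normDet_nonneg _
  rw [ENNReal.toReal_ofReal (hg0 _ hS), ENNReal.toReal_ofReal hJ0, smul_smul, mul_comm]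

/-! ### Total curvature and the rank of coordinate projections -/

/-- `headCoords` as a continuous linear map. -/
noncomputable def headCLM {d k : ℕ} (hk : 2 * k ≤ d) : Eucl d →L[ℝ] Eucl k :=
  LinearMap.toContinuousLinearMap
    { toFun := headCoords hk
      map_add' := fun x y => by ext i; simp [headCoords]
      map_smul' := fun c x => by ext i; simp [headCoords] }

@[simp]
theorem headCLM_apply {d k : ℕ} (hk : 2 * k ≤ d) (x : Eucl d) : headCLM hk x = headCoords hk x := rfl

theorem headCLM_surjective {d k : ℕ} (hk : 2 * k ≤ d) : Function.Surjective (headCLM hk) := by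
  intro y
  refine ⟨WithLp.toLp 2 fun i : Fin d => if h : (i : ℕ) < k then y ⟨i, h⟩ else 0, ?_⟩
  ext i
  simp [headCoords]

namespace IsLocalParam

variable {m d : ℕ} {S : Set (Eucl d)} {V : Set (Eucl m)} {φ : Eucl m → Eucl d}

theorem injOn (h : IsLocalParam S V φ) : InjOn φ V := fun x hx y hy hxy => by
  have := h.embedding.injective (a₁ := ⟨x, hx⟩) (a₂ := ⟨y, hy⟩) hxy
  exact congrArg Subtype.val this

/-- A local parametrization maps open sets to relatively open subsets of `S`. -/
theorem exists_image_eq_inter (h : IsLocalParam S V φ) {W : Set (Eucl m)} (hW : IsOpen W)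
    (hWV : W ⊆ V) : ∃ O, IsOpen O ∧ φ '' W = S ∩ O := by
  obtain ⟨U, hU, hSU⟩ := h.image_open
  obtain ⟨O', hO', hpre⟩ := h.embedding.isInducing.isOpen_iff.1
    (hW.preimage (continuous_subtype_val (p := (· ∈ V))))
  refine ⟨U ∩ O', hU.inter hO', ?_⟩
  have hmem : ∀ t (ht : t ∈ V), φ t ∈ O' ↔ t ∈ W := fun t ht => by
    have := congrArg (fun s => (⟨t, ht⟩ : V) ∈ s) hpre
    simpa using this
  ext y
  constructor
  · rintro ⟨t, ht, rfl⟩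
    have h1 : φ t ∈ S ∩ U := hSU ▸ mem_image_of_mem φ (hWV ht)
    exact ⟨h1.1, h1.2, (hmem t (hWV ht)).2 ht⟩
  · rintro ⟨hyS, hyU, hyO⟩
    obtain ⟨t, ht, rfl⟩ : y ∈ φ '' V := hSU ▸ ⟨hyS, hyU⟩
    exact ⟨t, (hmem t ht).1 hyO, rfl⟩

theorem image_subset (h : IsLocalParam S V φ) : φ '' V ⊆ S := by
  obtain ⟨U, _, hSU⟩ := h.image_open
  rw [hSU]; exact inter_subset_left

theorem nhdsWithin_le_map (h : IsLocalParam S V φ) {t : Eucl m} (ht : t ∈ V) :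
    𝓝[S] (φ t) ≤ Filter.map φ (𝓝 t) := by
  intro N hN
  obtain ⟨W, hWN, hW, htW⟩ := mem_nhds_iff.1 (Filter.inter_mem hN (h.isOpen_source.mem_nhds ht))
  obtain ⟨O, hO, himg⟩ := h.exists_image_eq_inter hW (hWN.trans inter_subset_right)
  have hmem : φ t ∈ S ∩ O := himg ▸ mem_image_of_mem φ htW
  filter_upwards [self_mem_nhdsWithin, mem_nhdsWithin_of_mem_nhds (hO.mem_nhds hmem.2)]
    with y hyS hyO
  obtain ⟨τ, hτ, rfl⟩ : y ∈ φ '' W := himg ▸ ⟨hyS, hyO⟩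
  exact (hWN hτ).1

theorem hasStrictFDerivAt (h : IsLocalParam S V φ) {t : Eucl m} (ht : t ∈ V) :
    HasStrictFDerivAt φ (fderiv ℝ φ t) t :=
  ((h.analytic t ht).contDiffAt (n := 1)).hasStrictFDerivAt one_ne_zero

/-- Points of `S` near `p` leave the tangent space of `S` at `p` only to second order. -/
theorem eventually_norm_starProjection_le (h : IsLocalParam S V φ) {t : Eucl m} (ht : t ∈ V)
    {c : ℝ} (hc : 0 < c) : ∀ᶠ y in 𝓝[S] (φ t),
      ‖(paramTangent φ t)ᗮ.starProjection (y - φ t)‖ ≤ c * ‖y - φ t‖ := by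
  set A := fderiv ℝ φ t with hA
  set Q := (paramTangent φ t)ᗮ.starProjection with hQ
  have hQA : ∀ v, Q (A v) = 0 := fun v => by
    rw [hQ, Submodule.starProjection_orthogonal_apply_eq_zero]
    exact LinearMap.mem_range_self (fderiv ℝ φ t : Eucl m →ₗ[ℝ] Eucl d) v
  obtain ⟨κ, hκ, hκA⟩ := (A : Eucl m →ₗ[ℝ] Eucl d).exists_antilipschitzWith
    (LinearMap.ker_eq_bot.2 (h.immersion t ht))
  have hκ' : (0 : ℝ) < κ := by exact_mod_cast hκ
  set c₁ := c / ((1 + c) * κ) with hc₁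
  have hc₁0 : 0 < c₁ := by positivity
  have hev : ∀ᶠ τ in 𝓝 t, ‖φ τ - φ t - A (τ - t)‖ ≤ c₁ * ‖τ - t‖ :=
    (h.hasStrictFDerivAt ht).hasFDerivAt.isLittleO.def hc₁0
  refine (h.nhdsWithin_le_map ht) (Filter.eventually_map.2 ?_)
  filter_upwards [hev] with τ hτ
  have h1 : ‖τ - t‖ ≤ κ * ‖A (τ - t)‖ := by
    have := hκA.le_mul_dist (τ - t) 0
    simpa [dist_eq_norm] using this
  have h2 : ‖A (τ - t)‖ ≤ ‖φ τ - φ t‖ + c₁ * ‖τ - t‖ := by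
    have := norm_sub_le (φ τ - φ t) (φ τ - φ t - A (τ - t))
    rw [sub_sub_cancel] at this
    linarith
  have h3 : Q (φ τ - φ t) = Q (φ τ - φ t - A (τ - t)) := by rw [map_sub Q _ (A _), hQA, sub_zero]
  have h4 : ‖Q (φ τ - φ t)‖ ≤ c₁ * ‖τ - t‖ := by
    rw [h3]
    exact (Submodule.norm_starProjection_apply_le _ _).trans hτ
  have h5 : c₁ * κ = c / (1 + c) := by rw [hc₁]; field_simp
  have h6 : ‖τ - t‖ ≤ κ * ‖φ τ - φ t‖ + c / (1 + c) * ‖τ - t‖ := by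
    rw [← h5]
    nlinarith
  have h7 : ‖τ - t‖ ≤ (1 + c) * κ * ‖φ τ - φ t‖ := by
    have : ‖τ - t‖ - c / (1 + c) * ‖τ - t‖ = ‖τ - t‖ / (1 + c) := by field_simp; ring
    have h8 : ‖τ - t‖ / (1 + c) ≤ κ * ‖φ τ - φ t‖ := by linarith
    rw [div_le_iff₀ (by positivity)] at h8
    linarith
  calc _ ≤ c₁ * ‖τ - t‖ := h4
    _ ≤ c₁ * ((1 + c) * κ * ‖φ τ - φ t‖) := by gcongr
    _ = _ := by rw [hc₁]; field_simp

theorem paramTangent_le {V' : Set (Eucl m)} {φ' : Eucl m → Eucl d} (h : IsLocalParam S V φ)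
    (h' : IsLocalParam S V' φ') {t t' : Eucl m} (ht : t ∈ V) (ht' : t' ∈ V') (heq : φ t = φ' t') :
    paramTangent φ t ≤ paramTangent φ' t' := by
  rintro _ ⟨x, rfl⟩
  change fderiv ℝ φ t x ∈ paramTangent φ' t'
  set Q := (paramTangent φ' t')ᗮ.starProjection with hQ
  suffices hz : Q (fderiv ℝ φ t x) = 0 by
    rwa [hQ, Submodule.starProjection_apply_eq_zero_iff, Submodule.orthogonal_orthogonal] at hz
  have hline : HasLineDerivAt ℝ φ (fderiv ℝ φ t x) t x :=
    (h.hasStrictFDerivAt ht).hasFDerivAt.hasLineDerivAt x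
  have htend := hline.tendsto_slope_zero
  have hS : Filter.Tendsto (fun s : ℝ => φ (t + s • x)) (𝓝[≠] 0) (𝓝[S] (φ' t')) := by
    have hcont : Filter.Tendsto (fun s : ℝ => t + s • x) (𝓝 0) (𝓝 t) := by
      have : ContinuousAt (fun s : ℝ => t + s • x) 0 := by fun_prop
      simpa [ContinuousAt] using this
    refine tendsto_nhdsWithin_iff.2 ⟨?_, ?_⟩
    · rw [← heq]
      exact ((h.analytic t ht).continuousAt.tendsto.comp hcont).mono_left nhdsWithin_le_nhds
    · have hV : ∀ᶠ s : ℝ in 𝓝 0, t + s • x ∈ V := hcont (h.isOpen_source.mem_nhds ht)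
      filter_upwards [hV.filter_mono nhdsWithin_le_nhds] with s hs
      exact h.image_subset (mem_image_of_mem φ hs)
  have hle : ∀ c : ℝ, 0 < c → ‖Q (fderiv ℝ φ t x)‖ ≤ c * ‖fderiv ℝ φ t x‖ := by
    intro c hc
    refine le_of_tendsto_of_tendsto ((Q.continuous.tendsto _).comp htend).norm
      (htend.norm.const_mul c) ?_
    filter_upwards [hS.eventually (h'.eventually_norm_starProjection_le ht' hc)] with s hs
    rw [Function.comp_apply, map_smul, norm_smul, norm_smul, heq]
    calc _ ≤ ‖s⁻¹‖ * (c * ‖φ (t + s • x) - φ' t'‖) := by gcongr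
      _ = _ := by ring
  have hlim : Filter.Tendsto (fun c : ℝ => c * ‖fderiv ℝ φ t x‖) (𝓝[>] 0) (𝓝 0) := by
    have : ContinuousAt (fun c : ℝ => c * ‖fderiv ℝ φ t x‖) 0 := by fun_prop
    simpa using this.tendsto.mono_left nhdsWithin_le_nhds
  have := ge_of_tendsto hlim (by filter_upwards [self_mem_nhdsWithin] with c hc using hle c hc)
  exact norm_le_zero_iff.1 this

/-- The tangent space does not depend on the parametrization. -/
theorem paramTangent_eq {V' : Set (Eucl m)} {φ' : Eucl m → Eucl d} (h : IsLocalParam S V φ)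
    (h' : IsLocalParam S V' φ') {t t' : Eucl m} (ht : t ∈ V) (ht' : t' ∈ V') (heq : φ t = φ' t') :
    paramTangent φ t = paramTangent φ' t' :=
  le_antisymm (h.paramTangent_le h' ht ht' heq) (h'.paramTangent_le h ht' ht heq.symm)

end IsLocalParam

/-- Where the rank of a family of linear maps is locally maximal, the derivative of the family maps the
kernel into the range. -/
theorem apply_mem_range_of_finrank_le {E F : Type*} [NormedAddCommGroup E] [NormedSpace ℝ E]
    [FiniteDimensional ℝ E] [NormedAddCommGroup F] [NormedSpace ℝ F] [FiniteDimensional ℝ F]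
    {A : E → E →L[ℝ] F} {A' : E →L[ℝ] E →L[ℝ] F} {t : E} (hA : HasFDerivAt A A' t)
    (hrank : ∀ᶠ τ in 𝓝 t, Module.finrank ℝ (A τ : E →ₗ[ℝ] F).range ≤
      Module.finrank ℝ (A t : E →ₗ[ℝ] F).range)
    {v : E} (hv : A t v = 0) (x : E) : A' x v ∈ (A t : E →ₗ[ℝ] F).range := by
  by_contra hu
  set r := Module.finrank ℝ (A t : E →ₗ[ℝ] F).range with hr
  obtain ⟨f, hf⟩ := exists_linearIndependent_of_le_finrank (R := ℝ)
    (M := (A t : E →ₗ[ℝ] F).range) (n := r) le_rfl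
  choose a ha using fun i => (f i).2
  have hLI : LinearIndependent ℝ fun i => A t (a i) := by
    have heq : (fun i => A t (a i)) = Submodule.subtype _ ∘ f := funext ha
    rw [heq]
    exact hf.map' (Submodule.subtype _) (Submodule.ker_subtype _)
  have hspan : Submodule.span ℝ (range fun i => A t (a i)) ≤ (A t : E →ₗ[ℝ] F).range := by
    rw [Submodule.span_le]
    rintro _ ⟨i, rfl⟩
    exact ⟨a i, rfl⟩
  -- the difference quotients of `A (t + s • x) v` tend to a vector outside the range of `A t`
  have hLI' : LinearIndependent ℝ (Fin.snoc (fun i => A t (a i)) (A' x v) : Fin (r + 1) → F) :=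
    linearIndependent_finSnoc.2 ⟨hLI, fun h => hu (hspan h)⟩
  have hline := (hA.hasLineDerivAt x).tendsto_slope_zero
  have hcont : Filter.Tendsto (fun s : ℝ => t + s • x) (𝓝[≠] 0) (𝓝 t) := by
    have : ContinuousAt (fun s : ℝ => t + s • x) 0 := by fun_prop
    simpa using this.tendsto.mono_left nhdsWithin_le_nhds
  have htend : Filter.Tendsto (fun s : ℝ => (Fin.snoc (fun i => A (t + s • x) (a i))
      (s⁻¹ • A (t + s • x) v) : Fin (r + 1) → F)) (𝓝[≠] 0)
      (𝓝 (Fin.snoc (fun i => A t (a i)) (A' x v))) := by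
    rw [tendsto_pi_nhds]
    intro i
    refine Fin.lastCases ?_ (fun i => ?_) i
    · simp only [Fin.snoc_last]
      have h1 := ((ContinuousLinearMap.apply ℝ F v).continuous.tendsto _).comp hline
      refine h1.congr fun s => ?_
      simp [hv]
    · simp only [Fin.snoc_castSucc]
      have h1 := ((ContinuousLinearMap.apply ℝ F (a i)).continuous.tendsto _).comp
        (hA.continuousAt.tendsto.comp hcont)
      exact h1
  have hev := htend.eventually (isOpen_setOfPred_linearIndependent.mem_nhds hLI')
  obtain ⟨s, hs, hs'⟩ := (hev.and (hcont.eventually hrank)).exists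
  have hcard := finrank_span_eq_card (R := ℝ) hs
  have hsub : Submodule.span ℝ (range (Fin.snoc (fun i => A (t + s • x) (a i))
      (s⁻¹ • A (t + s • x) v) : Fin (r + 1) → F)) ≤ (A (t + s • x) : E →ₗ[ℝ] F).range := by
    rw [Submodule.span_le]
    rintro _ ⟨i, rfl⟩
    refine Fin.lastCases ?_ (fun i => ?_) i
    · simp only [Fin.snoc_last]
      exact Submodule.smul_mem _ _ ⟨v, rfl⟩
    · simp only [Fin.snoc_castSucc]
      exact ⟨a i, rfl⟩
  have hle := Submodule.finrank_mono hsub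
  rw [hcard, Fintype.card_fin] at hle
  omega

/-- If `S` is totally curved, the projection of `S` to the first `k` coordinates is not
everywhere singular on any open piece of `S`. Otherwise, where its rank is locally maximal, a
normal vector pulled back from `ℝᵏ` would be orthogonal to `II(a, b)` for all `a` in the kernel of the
projection, which contains an `n`-dimensional space because `m - k + 1 > n`. -/
theorem IsTotallyCurved.not_eventually_finrank_lt {m n d k : ℕ} (hmn : m + n = d) (hn : 4 * n ≤ d)
    (hk : 2 * k ≤ d) {S : Set (Eucl d)} (hcurv : IsTotallyCurved m S) {V : Set (Eucl m)}
    {φ : Eucl m → Eucl d} (h : IsLocalParam S V φ) {t₀ : Eucl m} (ht₀ : t₀ ∈ V) :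
    ¬ ∀ᶠ t in 𝓝 t₀, Module.finrank ℝ
      ((paramTangent φ t).map (headCLM hk : Eucl d →ₗ[ℝ] Eucl k)) < k := by
  intro hlt
  set π := headCLM hk with hπ
  set rk : Eucl m → ℕ := fun t => Module.finrank ℝ ((paramTangent φ t).map (π : Eucl d →ₗ[ℝ] Eucl k))
    with hrk
  have hrange : ∀ (ψ : Eucl m → Eucl d) (t : Eucl m),
      (paramTangent ψ t).map (π : Eucl d →ₗ[ℝ] Eucl k) =
        ((π ∘L fderiv ℝ ψ t : Eucl m →L[ℝ] Eucl k) : Eucl m →ₗ[ℝ] Eucl k).range := by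
    intro ψ t
    exact (LinearMap.range_comp _ _).symm
  obtain ⟨U₀, hU₀sub, hU₀, ht₀U⟩ := mem_nhds_iff.1 (Filter.inter_mem hlt (h.isOpen_source.mem_nhds ht₀))
  obtain ⟨t₁, ht₁, hmax⟩ := (measure fun t => k - rk t).wf.has_min U₀ ⟨t₀, ht₀U⟩
  have hmax' : ∀ t ∈ U₀, rk t ≤ rk t₁ := by
    intro t ht
    have h1 : ¬ (k - rk t < k - rk t₁) := hmax t ht
    have h2 : rk t < k := (hU₀sub ht).1
    omega
  have ht₁V : t₁ ∈ V := (hU₀sub ht₁).2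
  -- the set of points of `U₀` of maximal rank is a neighbourhood of `t₁`
  have hlow : ∀ᶠ t in 𝓝 t₁, rk t₁ ≤ rk t := by
    have hc : ContinuousAt (fun t => π ∘L fderiv ℝ φ t) t₁ :=
      continuousAt_const.clm_comp (h.analytic t₁ ht₁V).fderiv.continuousAt
    have hmem : (π ∘L fderiv ℝ φ t₁) ∈
        {f : Eucl m →L[ℝ] Eucl k | ((rk t₁ : ℕ) : Cardinal) ≤ (f : Eucl m →ₗ[ℝ] Eucl k).rank} := by
      change ((rk t₁ : ℕ) : Cardinal) ≤ Module.rank ℝ _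
      rw [← Module.finrank_eq_rank, ← hrange]
    filter_upwards [hc ((isOpen_setOfPred_nat_le_rank (rk t₁)).mem_nhds hmem)] with t ht
    have ht' : ((rk t₁ : ℕ) : Cardinal) ≤ Module.rank ℝ _ := ht
    rw [← Module.finrank_eq_rank, ← hrange] at ht'
    exact_mod_cast ht'
  -- a totally curved point `φ' t'` in the part of `S` where the rank is maximal
  obtain ⟨W, hWsub, hW, ht₁W⟩ := mem_nhds_iff.1 (Filter.inter_mem hlow (hU₀.mem_nhds ht₁))
  have hWV : W ⊆ V := fun t ht => (hU₀sub (hWsub ht).2).2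
  obtain ⟨O, hO, himg⟩ := h.exists_image_eq_inter hW hWV
  have hpO : φ t₁ ∈ S ∩ O := himg ▸ mem_image_of_mem φ ht₁W
  obtain ⟨p, hpO', hpS, V', φ', t', h', ht', rfl, htc⟩ :=
    mem_closure_iff.1 (hcurv hpO.1) O hO hpO.2
  have hrk' : ∀ τ ∈ V', φ' τ ∈ O → Module.finrank ℝ
      ((π ∘L fderiv ℝ φ' τ : Eucl m →L[ℝ] Eucl k) : Eucl m →ₗ[ℝ] Eucl k).range = rk t₁ := by
    intro τ hτ hτO
    obtain ⟨t, ht, hteq⟩ : φ' τ ∈ φ '' W := himg ▸ ⟨h'.image_subset (mem_image_of_mem φ' hτ), hτO⟩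
    rw [← hrange, ← h.paramTangent_eq h' (hWV ht) hτ hteq]
    exact le_antisymm (hmax' t (hWsub ht).2) (hWsub ht).1
  set A : Eucl m → Eucl m →L[ℝ] Eucl k := fun τ => π ∘L fderiv ℝ φ' τ with hA
  have hAd : HasFDerivAt A ((ContinuousLinearMap.compL ℝ (Eucl m) (Eucl d) (Eucl k) π) ∘L
      fderiv ℝ (fderiv ℝ φ') t') t' :=
    (ContinuousLinearMap.compL ℝ (Eucl m) (Eucl d) (Eucl k) π).hasFDerivAt.comp t'
      (h'.analytic t' ht').fderiv.differentiableAt.hasFDerivAt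
  have hArank : ∀ᶠ τ in 𝓝 t', Module.finrank ℝ (A τ : Eucl m →ₗ[ℝ] Eucl k).range ≤
      Module.finrank ℝ (A t' : Eucl m →ₗ[ℝ] Eucl k).range := by
    filter_upwards [h'.isOpen_source.mem_nhds ht',
      (h'.analytic t' ht').continuousAt.preimage_mem_nhds (hO.mem_nhds hpO')] with τ hτ hτO
    rw [hrk' τ hτ hτO, hrk' t' ht' hpO']
  have hAt : Module.finrank ℝ (A t' : Eucl m →ₗ[ℝ] Eucl k).range < k := by
    rw [hrk' t' ht' hpO']
    exact (hU₀sub ht₁).1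
  -- a nonzero covector `y` killing the projected tangent space
  obtain ⟨y, hy, hy0⟩ : ∃ y ∈ (A t' : Eucl m →ₗ[ℝ] Eucl k).rangeᗮ, y ≠ 0 := by
    refine Submodule.exists_mem_ne_zero_of_ne_bot fun hbot => ?_
    rw [Submodule.orthogonal_eq_bot_iff] at hbot
    rw [hbot, finrank_top, finrank_euclideanSpace_fin] at hAt
    exact lt_irrefl _ hAt
  -- its pullback to `ℝᵈ` is normal to `S`
  set w : Eucl d := ContinuousLinearMap.adjoint π y with hw
  have hwinner : ∀ x, inner ℝ w x = inner ℝ y (π x) := fun x =>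
    ContinuousLinearMap.adjoint_inner_left π x y
  have hwN : w ∈ (paramTangent φ' t')ᗮ := by
    rw [Submodule.mem_orthogonal']
    rintro _ ⟨x, rfl⟩
    rw [hwinner]
    exact (Submodule.mem_orthogonal' _ _).1 hy _ ⟨x, rfl⟩
  -- an `n`-dimensional space of tangent vectors killed by the projection
  obtain ⟨f, hf⟩ := exists_linearIndependent_of_le_finrank (R := ℝ)
    (M := (A t' : Eucl m →ₗ[ℝ] Eucl k).ker) (n := n) (by
      have := (A t' : Eucl m →ₗ[ℝ] Eucl k).finrank_range_add_finrank_ker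
      rw [finrank_euclideanSpace_fin] at this
      omega)
  have hf' : LinearIndependent ℝ fun i => fderiv ℝ φ' t' (f i) :=
    (hf.map' (Submodule.subtype _) (Submodule.ker_subtype _)).map'
      (fderiv ℝ φ' t' : Eucl m →ₗ[ℝ] Eucl d) (LinearMap.ker_eq_bot.2 (h'.immersion t' ht'))
  set X := Submodule.span ℝ (range fun i => fderiv ℝ φ' t' (f i)) with hX
  have hXT : X ≤ paramTangent φ' t' := by
    rw [hX, Submodule.span_le]
    rintro _ ⟨i, rfl⟩
    exact ⟨f i, rfl⟩
  have hXπ : X ≤ (π : Eucl d →ₗ[ℝ] Eucl k).ker := by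
    rw [hX, Submodule.span_le]
    rintro _ ⟨i, rfl⟩
    exact (f i).2
  have hspan := htc X hXT (by
    rw [hX, finrank_span_eq_card hf', Fintype.card_fin]; omega)
  have hle : Submodule.span ℝ {v | ∃ a b : Eucl m, fderiv ℝ φ' t' a ∈ X ∧
      v = secondFundamentalForm φ' t' a b} ≤ (ℝ ∙ w)ᗮ := by
    rw [Submodule.span_le]
    rintro _ ⟨a, b, hab, rfl⟩
    change _ ∈ (ℝ ∙ w)ᗮ
    rw [Submodule.mem_orthogonal_singleton_iff_inner_right, secondFundamentalForm,
      ← Submodule.inner_starProjection_left_eq_right,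
      Submodule.starProjection_eq_self_iff.2 hwN, hwinner]
    have hsymm : fderiv ℝ (fderiv ℝ φ') t' a b = fderiv ℝ (fderiv ℝ φ') t' b a :=
      ((h'.analytic t' ht').contDiffAt (n := 2)).isSymmSndFDerivAt (by simp) a b
    rw [hsymm]
    have hmem := apply_mem_range_of_finrank_le hAd hArank (v := a) (LinearMap.mem_ker.1 (hXπ hab)) b
    exact (Submodule.mem_orthogonal' _ _).1 hy _ hmem
  rw [hspan] at hle
  have hww : inner ℝ w w = 0 := Submodule.mem_orthogonal_singleton_iff_inner_right.1 (hle hwN)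
  obtain ⟨x, hx⟩ := headCLM_surjective hk y
  have hw0 : w = 0 := inner_self_eq_zero.1 hww
  have := hwinner x
  rw [hw0, inner_zero_left, hπ, hx] at this
  exact hy0 (inner_self_eq_zero.1 this.symm)

/-! ### The Gram determinant of a coordinate projection -/

/-- The Jacobian matrix of the projection of a parametrized submanifold to the first `k` coordinates. -/
noncomputable def headJacobian {m d k : ℕ} (hk : 2 * k ≤ d) (φ : Eucl m → Eucl d) (t : Eucl m) :
    Matrix (Fin k) (Fin m) ℝ :=
  Matrix.of fun i j => headCoords hk (fderiv ℝ φ t (EuclideanSpace.single j 1)) i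

/-- The Gram determinant `det (J Jᵀ)`, nonzero exactly where the projection is a submersion. -/
noncomputable def headGram {m d k : ℕ} (hk : 2 * k ≤ d) (φ : Eucl m → Eucl d) (t : Eucl m) : ℝ :=
  (headJacobian hk φ t * (headJacobian hk φ t).transpose).det

/-- The columns of `Jᵀ adj (J Jᵀ)`: vector fields on the parameter domain lifting the coordinate fields of
`ℝᵏ`, multiplied by the Gram determinant to be regular everywhere. -/
noncomputable def headLift {m d k : ℕ} (hk : 2 * k ≤ d) (φ : Eucl m → Eucl d) (t : Eucl m) :
    Matrix (Fin m) (Fin k) ℝ :=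
  (headJacobian hk φ t).transpose *
    (headJacobian hk φ t * (headJacobian hk φ t).transpose).adjugate

section

variable {m d k : ℕ} (hk : 2 * k ≤ d) {φ : Eucl m → Eucl d}

theorem headJacobian_mul_headLift (t : Eucl m) :
    headJacobian hk φ t * headLift hk φ t = headGram hk φ t • (1 : Matrix (Fin k) (Fin k) ℝ) := by
  rw [headLift, ← Matrix.mul_assoc, Matrix.mul_adjugate, headGram]

theorem sum_headLift_smul_fderiv (t : Eucl m) (i : Fin k) :
    ∑ j, headLift hk φ t j i • headCoords hk (fderiv ℝ φ t (EuclideanSpace.single j 1)) =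
      headGram hk φ t • EuclideanSpace.single i (1 : ℝ) := by
  ext l
  have h := congrFun (congrFun (headJacobian_mul_headLift hk (φ := φ) t) l) i
  rw [Matrix.mul_apply] at h
  simp only [Matrix.smul_apply, Matrix.one_apply] at h
  simp only [WithLp.ofLp_sum, Finset.sum_apply, PiLp.smul_apply, smul_eq_mul]
  rw [PiLp.single_apply]
  rw [smul_eq_mul] at h
  convert h using 2 with j
  · simp [headJacobian, mul_comm]

/-- Where the Gram determinant vanishes, the projection is not a submersion. -/
theorem finrank_lt_of_headGram_eq_zero {t : Eucl m} (h : headGram hk φ t = 0) :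
    Module.finrank ℝ ((paramTangent φ t).map (headCLM hk : Eucl d →ₗ[ℝ] Eucl k)) < k := by
  obtain ⟨v, hv0, hv⟩ := Matrix.exists_mulVec_eq_zero_iff.2 h
  have hv' : (headJacobian hk φ t).transpose.mulVec v = 0 := by
    have h1 := Matrix.self_mul_conjTranspose_mulVec_eq_zero (headJacobian hk φ t) v
    rw [Matrix.conjTranspose_eq_transpose_of_trivial] at h1
    exact h1.1 hv
  by_contra hge
  have htop : (paramTangent φ t).map (headCLM hk : Eucl d →ₗ[ℝ] Eucl k) = ⊤ := by
    apply Submodule.eq_top_of_finrank_eq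
    have := Submodule.finrank_le ((paramTangent φ t).map (headCLM hk : Eucl d →ₗ[ℝ] Eucl k))
    rw [finrank_euclideanSpace_fin] at this ⊢
    omega
  have horth : ∀ x : Eucl m, inner ℝ (WithLp.toLp 2 v : Eucl k) (headCoords hk (fderiv ℝ φ t x)) = 0 := by
    intro x
    set L : Eucl m →L[ℝ] ℝ := innerSL ℝ (WithLp.toLp 2 v : Eucl k) ∘L headCLM hk ∘L fderiv ℝ φ t
    have hL : (L : Eucl m →ₗ[ℝ] ℝ) = 0 := by
      refine (EuclideanSpace.basisFun (Fin m) ℝ).toBasis.ext fun j => ?_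
      have h2 := congrFun hv' j
      simp only [Matrix.mulVec, dotProduct, Matrix.transpose_apply, headJacobian, Matrix.of_apply,
        Pi.zero_apply] at h2
      simp only [L, OrthonormalBasis.coe_toBasis, EuclideanSpace.basisFun_apply,
        ContinuousLinearMap.coe_coe, ContinuousLinearMap.comp_apply, innerSL_apply_apply, headCLM_apply,
        LinearMap.zero_apply, PiLp.inner_apply]
      rw [← h2]
      simp
    exact congrArg (fun l : Eucl m →ₗ[ℝ] ℝ => l x) hL
  have hmem : (WithLp.toLp 2 v : Eucl k) ∈ (paramTangent φ t).map (headCLM hk : Eucl d →ₗ[ℝ] Eucl k) := by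
    rw [htop]; trivial
  obtain ⟨_, ⟨x, rfl⟩, hx⟩ := hmem
  have h3 := horth x
  have h4 : headCoords hk (fderiv ℝ φ t x) = WithLp.toLp 2 v := hx
  rw [h4, inner_self_eq_zero] at h3
  exact hv0 (by simpa using congrArg (WithLp.ofLp) h3)

theorem analyticAt_headJacobian {t : Eucl m} (h : AnalyticAt ℝ φ t) (i : Fin k) (j : Fin m) :
    AnalyticAt ℝ (fun t => headJacobian hk φ t i j) t := by
  let L : (Eucl m →L[ℝ] Eucl d) →L[ℝ] ℝ := (EuclideanSpace.proj i : Eucl k →L[ℝ] ℝ) ∘L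
    headCLM hk ∘L ContinuousLinearMap.apply ℝ (Eucl d) (EuclideanSpace.single j (1 : ℝ))
  exact (L.analyticAt _).comp h.fderiv

theorem AnalyticAt.matrix_det {E ι : Type*} [NormedAddCommGroup E] [NormedSpace ℝ E] [Fintype ι]
    [DecidableEq ι] {M : E → Matrix ι ι ℝ} {t : E}
    (h : ∀ i j, AnalyticAt ℝ (fun t => M t i j) t) : AnalyticAt ℝ (fun t => (M t).det) t := by
  simp only [Matrix.det_apply']
  exact Finset.analyticAt_fun_sum _ fun σ _ =>
    analyticAt_const.mul (Finset.analyticAt_fun_prod _ fun i _ => h _ _)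

theorem analyticAt_headJacobian_mul_transpose {t : Eucl m} (h : AnalyticAt ℝ φ t) (i j : Fin k) :
    AnalyticAt ℝ (fun t => (headJacobian hk φ t * (headJacobian hk φ t).transpose) i j) t := by
  simp only [Matrix.mul_apply, Matrix.transpose_apply]
  exact Finset.analyticAt_fun_sum _ fun l _ =>
    (analyticAt_headJacobian hk h i l).mul (analyticAt_headJacobian hk h j l)

theorem analyticAt_headGram {t : Eucl m} (h : AnalyticAt ℝ φ t) : AnalyticAt ℝ (headGram hk φ) t :=
  AnalyticAt.matrix_det fun i j => analyticAt_headJacobian_mul_transpose hk h i j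

theorem analyticAt_headLift {t : Eucl m} (h : AnalyticAt ℝ φ t) (j : Fin m) (i : Fin k) :
    AnalyticAt ℝ (fun t => headLift hk φ t j i) t := by
  simp only [headLift, Matrix.mul_apply, Matrix.transpose_apply]
  refine Finset.analyticAt_fun_sum _ fun l _ => (analyticAt_headJacobian hk h l j).mul ?_
  simp only [Matrix.adjugate_apply]
  refine AnalyticAt.matrix_det fun a b => ?_
  simp only [Matrix.updateRow_apply]
  split_ifs
  · exact analyticAt_const
  · exact analyticAt_headJacobian_mul_transpose hk h a b

end

/-- On a totally curved submanifold the Gram determinant does not vanish identically near any point. -/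
theorem IsTotallyCurved.not_eventually_headGram_eq_zero {m n d k : ℕ} (hmn : m + n = d)
    (hn : 4 * n ≤ d) (hk : 2 * k ≤ d) {S : Set (Eucl d)} (hcurv : IsTotallyCurved m S)
    {V : Set (Eucl m)} {φ : Eucl m → Eucl d} (h : IsLocalParam S V φ) {t₀ : Eucl m} (ht₀ : t₀ ∈ V) :
    ¬ ∀ᶠ t in 𝓝 t₀, headGram hk φ t = 0 := fun hz =>
  hcurv.not_eventually_finrank_lt hmn hn hk h ht₀
    (hz.mono fun _ ht => finrank_lt_of_headGram_eq_zero hk ht)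

/-! ### Integration by parts along lifted vector fields -/

theorem continuous_of_tsupport_subset_of_eq_zero {X Y : Type*} [TopologicalSpace X]
    [TopologicalSpace Y] [Zero Y] {V T : Set X} (hV : IsOpen V) (hT : IsClosed T) (hTV : T ⊆ V)
    {f : X → Y} (hf : ContinuousOn f V) (h0 : ∀ x ∉ T, f x = 0) : Continuous f :=
  continuous_of_tsupport fun _ hx => hf.continuousAt (hV.mem_nhds (hTV
    (closure_minimal (fun x hx => by by_contra h; exact hx (h0 x h)) hT hx)))

theorem contDiff_of_eq_zero {E F : Type*} [NormedAddCommGroup E] [NormedSpace ℝ E]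
    [NormedAddCommGroup F] [NormedSpace ℝ F] {V T : Set E} (hV : IsOpen V) (hT : IsClosed T)
    (hTV : T ⊆ V) {n : WithTop ℕ∞} {f : E → F} (hf : ContDiffOn ℝ n f V) (h0 : ∀ x ∉ T, f x = 0) :
    ContDiff ℝ n f := by
  rw [contDiff_iff_contDiffAt]
  intro x
  by_cases hx : x ∈ T
  · exact hf.contDiffAt (hV.mem_nhds (hTV hx))
  · exact contDiffAt_const.congr_of_eventuallyEq
      (Filter.eventually_of_mem (hT.isOpen_compl.mem_nhds hx) h0)

theorem tsupport_subset_of_eq_zero {X Y : Type*} [TopologicalSpace X] [Zero Y] {T : Set X}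
    (hT : IsClosed T) {f : X → Y} (h0 : ∀ x ∉ T, f x = 0) : tsupport f ⊆ T :=
  closure_minimal (fun x hx => by by_contra h; exact hx (h0 x h)) hT

/-- Integration by parts: the integral of the derivative of a bounded function along a
compactly supported vector field `X` is controlled by the divergence of `X`. -/
theorem norm_integral_sum_smul_fderiv_le {m : ℕ} {V K' : Set (Eucl m)} (hV : IsOpen V)
    (hK' : IsCompact K') (hKV : K' ⊆ V) {X : Fin m → Eucl m → ℝ} (hX : ∀ j, ContDiff ℝ 1 (X j))
    (hX0 : ∀ j, ∀ t ∉ K', X j t = 0) {g : Eucl m → ℂ} (hg : ContDiffOn ℝ 1 g V)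
    (hg1 : ∀ t ∈ V, ‖g t‖ ≤ 1) {M : ℝ}
    (hdiv : ∀ j, ∀ t ∈ K', ‖fderiv ℝ (X j) t‖ ≤ M) :
    ‖∫ t, ∑ j, X j t • fderiv ℝ g t (EuclideanSpace.single j 1)‖ ≤
      m * (M * (volume K').toReal) := by
  have hKc := hK'.isClosed
  have hgd : ContinuousOn (fderiv ℝ g) V := (hg.continuousOn_fderiv_of_isOpen hV le_rfl)
  have hsupp : ∀ {f : Eucl m → ℂ}, (∀ t ∉ K', f t = 0) → HasCompactSupport f := fun h0 =>
    HasCompactSupport.intro hK' h0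
  have hts : ∀ j, tsupport (X j) ⊆ K' := fun j => tsupport_subset_of_eq_zero hKc (hX0 j)
  have hdX : ∀ j, ∀ t ∉ K', fderiv ℝ (X j) t = 0 := fun j t ht =>
    fderiv_of_notMem_tsupport (𝕜 := ℝ) fun h => ht (hts j h)
  have hint : ∀ {f : Eucl m → ℂ}, ContinuousOn f V → (∀ t ∉ K', f t = 0) → Integrable f :=
    fun hf h0 => (continuous_of_tsupport_subset_of_eq_zero hV hKc hKV hf h0).integrable_of_hasCompactSupport
      (hsupp h0)
  have h1 : ∀ j, Integrable fun t => X j t • fderiv ℝ g t (EuclideanSpace.single j 1) := fun j =>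
    hint ((hX j).continuous.continuousOn.smul (hgd.clm_apply continuousOn_const))
      fun t ht => by simp [hX0 j t ht]
  have h2 : ∀ j, Integrable fun t => fderiv ℝ (X j) t (EuclideanSpace.single j 1) • g t := fun j =>
    hint ((((hX j).continuous_fderiv one_ne_zero).clm_apply continuous_const).continuousOn.smul
      hg.continuousOn) fun t ht => by simp [hdX j t ht]
  have h3 : ∀ j, Integrable fun t => X j t • g t := fun j =>
    hint ((hX j).continuous.continuousOn.smul hg.continuousOn) fun t ht => by simp [hX0 j t ht]
  rw [integral_finsetSum _ fun j _ => h1 j]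
  refine (norm_sum_le _ _).trans ?_
  have hbound : ∀ j, ‖∫ t, X j t • fderiv ℝ g t (EuclideanSpace.single j 1)‖ ≤
      M * (volume K').toReal := by
    intro j
    rw [integral_smul_fderiv_eq_neg_fderiv_smul_of_integrable (h2 j) (h1 j) (h3 j)
      (fun t _ => (hX j).differentiable one_ne_zero t)
      (fun t ht => (hg.contDiffAt (hV.mem_nhds (hKV (hts j ht)))).differentiableAt one_ne_zero),
      norm_neg]
    have hset : ∫ t, fderiv ℝ (X j) t (EuclideanSpace.single j 1) • g t =
        ∫ t in K', fderiv ℝ (X j) t (EuclideanSpace.single j 1) • g t :=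
      (setIntegral_eq_integral_of_forall_compl_eq_zero fun t ht => by simp [hdX j t ht]).symm
    rw [hset]
    refine norm_setIntegral_le_of_norm_le_const hK'.measure_lt_top fun t ht => ?_
    rw [norm_smul]
    calc ‖fderiv ℝ (X j) t (EuclideanSpace.single j 1)‖ * ‖g t‖
        ≤ (‖fderiv ℝ (X j) t‖ * ‖(EuclideanSpace.single j 1 : Eucl m)‖) * 1 := by
          gcongr
          · exact ContinuousLinearMap.le_opNorm _ _
          · exact hg1 t (hKV ht)
      _ ≤ M := by simpa using hdiv j t ht
  calc _ ≤ ∑ _j : Fin m, M * (volume K').toReal := Finset.sum_le_sum fun j _ => hbound j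
    _ = _ := by simp

/-- Transport along a vector field: if `X` lifts `w • h` through `G`, then translating by `h` changes the
integral of `u ∘ G` against `w` by at most the divergence of `X`. -/
theorem norm_integral_translate_sub_le {m k : ℕ} {V K' : Set (Eucl m)} (hV : IsOpen V)
    (hK' : IsCompact K') (hKV : K' ⊆ V) {G : Eucl m → Eucl k} (hG : ContDiffOn ℝ 1 G V)
    {X : Fin m → Eucl m → ℝ} (hX : ∀ j, ContDiff ℝ 1 (X j)) (hX0 : ∀ j, ∀ t ∉ K', X j t = 0)
    {w : Eucl m → ℝ} (hw : ContinuousOn w V) (hw0 : ∀ t ∉ K', w t = 0) {h : Eucl k}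
    (hlift : ∀ t ∈ V, ∑ j, X j t • fderiv ℝ G t (EuclideanSpace.single j 1) = w t • h)
    {u : Eucl k → ℂ} (hu : ContDiff ℝ 1 u) (hu1 : ∀ y, ‖u y‖ ≤ 1) {M : ℝ}
    (hdiv : ∀ j, ∀ t ∈ K', ‖fderiv ℝ (X j) t‖ ≤ M) :
    ‖∫ t, w t • (u (G t + h) - u (G t))‖ ≤ m * (M * (volume K').toReal) := by
  have hKc := hK'.isClosed
  have hint : ∀ {f : Eucl m → ℂ}, ContinuousOn f V → (∀ t ∉ K', f t = 0) → Integrable f :=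
    fun hf h0 => (continuous_of_tsupport_subset_of_eq_zero hV hKc hKV hf h0).integrable_of_hasCompactSupport
      (HasCompactSupport.intro hK' h0)
  set F : ℝ → Eucl m → ℂ := fun s t => w t • u (G t + s • h) with hF
  set F' : ℝ → Eucl m → ℂ := fun s t => w t • fderiv ℝ u (G t + s • h) h with hF'
  have hFc : ∀ s, ContinuousOn (F s) V := fun s =>
    hw.smul (hu.continuous.comp_continuousOn (hG.continuousOn.add continuousOn_const))
  have hF'c : ∀ s, ContinuousOn (F' s) V := fun s =>
    hw.smul (((hu.continuous_fderiv one_ne_zero).comp_continuousOn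
      (hG.continuousOn.add continuousOn_const)).clm_apply continuousOn_const)
  have hF0 : ∀ s, ∀ t ∉ K', F s t = 0 := fun s t ht => by simp [hF, hw0 t ht]
  have hF'0 : ∀ s, ∀ t ∉ K', F' s t = 0 := fun s t ht => by simp [hF', hw0 t ht]
  have hFi : ∀ s, Integrable (F s) := fun s => hint (hFc s) (hF0 s)
  have hF'i : ∀ s, Integrable (F' s) := fun s => hint (hF'c s) (hF'0 s)
  -- a bound for the derivative in `s`, uniform on bounded sets
  obtain ⟨B, hB⟩ : ∃ B, ∀ p ∈ Icc (-1 : ℝ) 2 ×ˢ K', ‖F' p.1 p.2‖ ≤ B := by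
    refine (isCompact_Icc.prod hK').exists_bound_of_continuousOn (f := fun p => F' p.1 p.2) ?_
    have hsnd : MapsTo Prod.snd (Icc (-1 : ℝ) 2 ×ˢ K') V := fun p hp => hKV hp.2
    refine (hw.comp continuousOn_snd hsnd).smul (ContinuousOn.clm_apply ?_ continuousOn_const)
    refine (hu.continuous_fderiv one_ne_zero).comp_continuousOn ?_
    exact (hG.continuousOn.comp continuousOn_snd hsnd).add (continuousOn_fst.smul continuousOn_const)
  have hderiv : ∀ s ∈ Icc (0 : ℝ) 1, HasDerivAt (fun s => ∫ t, F s t) (∫ t, F' s t) s := by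
    intro s hs
    have hbi : Integrable (K'.indicator fun _ : Eucl m => B) :=
      (integrable_indicator_iff hKc.measurableSet).2
        (integrableOn_const hK'.measure_lt_top.ne)
    refine (hasDerivAt_integral_of_dominated_loc_of_deriv_le (bound := K'.indicator fun _ => B)
      (Ioo_mem_nhds (show (-1 : ℝ) < s by linarith [hs.1]) (show s < 2 by linarith [hs.2]))
      (Filter.Eventually.of_forall fun s => (hFi s).aestronglyMeasurable) (hFi s)
      (hF'i s).aestronglyMeasurable ?_ hbi ?_).2
    · refine Filter.Eventually.of_forall fun t τ hτ => ?_
      by_cases ht : t ∈ K'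
      · rw [indicator_of_mem ht]
        exact hB (τ, t) ⟨Ioo_subset_Icc_self hτ, ht⟩
      · rw [indicator_of_notMem ht, hF'0 τ t ht, norm_zero]
    · refine Filter.Eventually.of_forall fun t τ _ => ?_
      have h1 : HasDerivAt (fun τ : ℝ => G t + τ • h) h τ := by
        have := ((hasDerivAt_id τ).smul_const h).const_add (G t)
        rwa [one_smul] at this
      exact (((hu.differentiable one_ne_zero _).hasFDerivAt).comp_hasDerivAt τ h1).const_smul (w t)
  have hbound : ∀ s, ‖∫ t, F' s t‖ ≤ m * (M * (volume K').toReal) := by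
    intro s
    have hgC : ContDiffOn ℝ 1 (fun t => u (G t + s • h)) V :=
      hu.comp_contDiffOn (hG.add contDiffOn_const)
    have heq : ∀ t, F' s t = ∑ j, X j t •
        fderiv ℝ (fun t => u (G t + s • h)) t (EuclideanSpace.single j 1) := by
      intro t
      by_cases ht : t ∈ V
      · have hGt : HasFDerivAt (fun t => G t + s • h) (fderiv ℝ G t) t :=
          ((hG.contDiffAt (hV.mem_nhds ht)).differentiableAt one_ne_zero).hasFDerivAt.add_const _
        have h1 : fderiv ℝ (fun t => u (G t + s • h)) t =
            fderiv ℝ u (G t + s • h) ∘L fderiv ℝ G t :=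
          (((hu.differentiable one_ne_zero _).hasFDerivAt).comp t hGt).fderiv
        rw [h1]
        simp only [ContinuousLinearMap.comp_apply]
        have h2 := hlift t ht
        simp only [← map_smul, ← map_sum] at h2 ⊢
        rw [h2, map_smul]
      · have ht' : t ∉ K' := fun h => ht (hKV h)
        rw [hF'0 s t ht']
        simp [hX0 _ t ht']
    simp only [heq]
    exact norm_integral_sum_smul_fderiv_le hV hK' hKV hX hX0 hgC (fun t _ => hu1 _) hdiv
  have hmv := norm_image_sub_le_of_norm_deriv_le_segment_01' (f := fun s => ∫ t, F s t)
    (fun s hs => (hderiv s hs).hasDerivWithinAt) (fun s _ => hbound s)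
  have hsub : ∫ t, w t • (u (G t + h) - u (G t)) = (∫ t, F 1 t) - ∫ t, F 0 t := by
    rw [← integral_sub (hFi 1) (hFi 0)]
    refine integral_congr_ae (Filter.Eventually.of_forall fun t => ?_)
    simp [hF, smul_sub]
  rw [hsub]
  exact hmv

/-- Bound for the divergence of the regularized vector fields `b / (D ^ 2 + ε) · P`. -/
theorem norm_fderiv_mul_inv_sq_add_mul_le {E : Type*} [NormedAddCommGroup E] [NormedSpace ℝ E]
    {b D P : E → ℝ} {t : E} {A ε : ℝ} (hA : 0 ≤ A) (hε : 0 < ε) (hε1 : ε ≤ 1)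
    (hb : DifferentiableAt ℝ b t) (hD : DifferentiableAt ℝ D t) (hP : DifferentiableAt ℝ P t)
    (hb1 : |b t| ≤ 1) (hb' : ‖fderiv ℝ b t‖ ≤ 1) (hD1 : |D t| ≤ A) (hD' : ‖fderiv ℝ D t‖ ≤ A)
    (hP1 : |P t| ≤ A) (hP' : ‖fderiv ℝ P t‖ ≤ A) :
    ‖fderiv ℝ (fun t => b t * (D t ^ 2 + ε)⁻¹ * P t) t‖ ≤ (2 * A + 2 * A ^ 3) / ε ^ 2 := by
  have hpos : 0 < D t ^ 2 + ε := by positivity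
  have hinv : HasFDerivAt (fun t => (D t ^ 2 + ε)⁻¹)
      (-((D t ^ 2 + ε) ^ 2)⁻¹ • ((2 * D t) • fderiv ℝ D t)) t := by
    have h1 : HasFDerivAt (fun t => D t ^ 2 + ε) ((2 * D t) • fderiv ℝ D t) t := by
      have := (hD.hasFDerivAt.pow 2).add_const ε
      simpa using this
    exact (hasDerivAt_inv hpos.ne').comp_hasFDerivAt t h1
  have hle : (D t ^ 2 + ε)⁻¹ ≤ 1 / ε := by
    rw [one_div]
    exact inv_anti₀ hε (by nlinarith [sq_nonneg (D t)])
  have hε2 : 1 / ε ≤ 1 / ε ^ 2 := by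
    apply one_div_le_one_div_of_le (by positivity)
    nlinarith
  have hinv0 : 0 ≤ (D t ^ 2 + ε)⁻¹ := by positivity
  have hinvn : ‖-((D t ^ 2 + ε) ^ 2)⁻¹ • ((2 * D t) • fderiv ℝ D t)‖ ≤ 2 * A ^ 2 / ε ^ 2 := by
    rw [norm_smul, norm_smul, norm_neg, norm_inv, Real.norm_of_nonneg (by positivity), norm_mul,
      Real.norm_eq_abs 2, abs_two, Real.norm_eq_abs]
    have h2 : ((D t ^ 2 + ε) ^ 2)⁻¹ ≤ 1 / ε ^ 2 := by
      rw [one_div]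
      exact inv_anti₀ (by positivity) (by gcongr; nlinarith [sq_nonneg (D t)])
    calc _ ≤ 1 / ε ^ 2 * (2 * A * A) := by gcongr
      _ = _ := by ring
  rw [((hb.hasFDerivAt.fun_mul hinv).fun_mul hP.hasFDerivAt).fderiv]
  refine (norm_add_le _ _).trans ?_
  have h3 : ‖(b t * (D t ^ 2 + ε)⁻¹) • fderiv ℝ P t‖ ≤ A / ε ^ 2 := by
    rw [norm_smul, norm_mul, Real.norm_eq_abs, Real.norm_of_nonneg hinv0]
    calc |b t| * (D t ^ 2 + ε)⁻¹ * ‖fderiv ℝ P t‖ ≤ 1 * (1 / ε ^ 2) * A := by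
          gcongr; exact hle.trans hε2
      _ = _ := by ring
  have h4 : ‖P t • (b t • (-((D t ^ 2 + ε) ^ 2)⁻¹ • ((2 * D t) • fderiv ℝ D t)) +
      (D t ^ 2 + ε)⁻¹ • fderiv ℝ b t)‖ ≤ A * (2 * A ^ 2 / ε ^ 2 + 1 / ε ^ 2) := by
    rw [norm_smul, Real.norm_eq_abs]
    gcongr
    refine (norm_add_le _ _).trans (add_le_add ?_ ?_)
    · rw [norm_smul, Real.norm_eq_abs]
      calc _ ≤ 1 * (2 * A ^ 2 / ε ^ 2) := by gcongr
        _ = _ := one_mul _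
    · rw [norm_smul, Real.norm_of_nonneg hinv0]
      calc _ ≤ 1 / ε ^ 2 * 1 := by gcongr; exact hle.trans hε2
        _ = _ := mul_one _
  calc _ ≤ A / ε ^ 2 + A * (2 * A ^ 2 / ε ^ 2 + 1 / ε ^ 2) := add_le_add h3 h4
    _ = _ := by ring

theorem norm_setIntegral_le_of_le_indicator_add {m : ℕ} {K' N : Set (Eucl m)} (hK' : IsCompact K')
    (hN : MeasurableSet N) (hNK : N ⊆ K') {f : Eucl m → ℂ} {s : ℝ}
    (hf : ∀ t ∈ K', ‖f t‖ ≤ 2 * (N.indicator (fun _ => 1) t + s)) :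
    ‖∫ t in K', f t‖ ≤ 2 * ((volume N).toReal + s * (volume K').toReal) := by
  have hind : IntegrableOn (N.indicator (fun _ => (1 : ℝ))) K' :=
    (integrableOn_const hK'.measure_lt_top.ne).indicator hN
  have hconst : IntegrableOn (fun _ : Eucl m => s) K' := integrableOn_const hK'.measure_lt_top.ne
  refine (norm_integral_le_of_norm_le ((hind.add hconst).const_mul 2)
    ((ae_restrict_iff' hK'.isClosed.measurableSet).2 (Filter.Eventually.of_forall hf))).trans ?_
  refine le_of_eq ?_
  rw [integral_const_mul]
  congr 1
  refine (integral_add hind hconst).trans ?_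
  rw [setIntegral_const, integral_indicator hN, Measure.restrict_restrict hN,
    inter_eq_self_of_subset_left hNK, setIntegral_const]
  simp [Measure.real, mul_comm]

set_option maxHeartbeats 800000 in
/-- Power-saving continuity of translates: the distribution of `G` with respect to a smooth density
on a compact set changes by at most a power of `‖h‖` in total variation when translated by `h`,
provided the singular set `{D = 0}` of `G` has small neighbourhoods. -/
theorem exists_norm_integral_smul_translate_sub_le {m k : ℕ} {V K' : Set (Eucl m)} (hV : IsOpen V)
    (hK' : IsCompact K') (hKV : K' ⊆ V) {G : Eucl m → Eucl k} (hG : ContDiffOn ℝ 1 G V)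
    {D : Eucl m → ℝ} (hD : ContDiffOn ℝ 1 D V) {Z : Eucl m → Matrix (Fin m) (Fin k) ℝ}
    (hZ : ∀ j i, ContDiffOn ℝ 1 (fun t => Z t j i) V)
    (hGZ : ∀ t ∈ V, ∀ i, ∑ j, Z t j i • fderiv ℝ G t (EuclideanSpace.single j 1) =
      D t • EuclideanSpace.single i (1 : ℝ))
    {γ : ℝ} (hγ1 : γ ≤ 1) {C₀ : ℝ} (hC₀ : 0 ≤ C₀)
    (hsub : ∀ ε : ℝ, 0 < ε → ε ≤ 1 → volume {t ∈ K' | |D t| ≤ ε} ≤ ENNReal.ofReal (C₀ * ε ^ γ)) :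
    ∃ C : ℝ, 0 ≤ C ∧ ∀ b : Eucl m → ℝ, ContDiff ℝ 1 b → (∀ t ∉ K', b t = 0) → (∀ t, |b t| ≤ 1) →
      (∀ t, ‖fderiv ℝ b t‖ ≤ 1) → ∀ u : Eucl k → ℂ, ContDiff ℝ 1 u → (∀ y, ‖u y‖ ≤ 1) →
        ∀ h : Eucl k, ‖h‖ ≤ 1 → ‖∫ t, b t • (u (G t + h) - u (G t))‖ ≤ C * ‖h‖ ^ (γ / 12) := by
  have hKc := hK'.isClosed
  -- the fields `D • Z` and a common bound for everything on `K'`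
  set P : Fin m → Fin k → Eucl m → ℝ := fun j i t => D t * Z t j i with hP
  have hPs : ∀ j i, ContDiffOn ℝ 1 (P j i) V := fun j i => hD.mul (hZ j i)
  have hbd : ∀ {f : Eucl m → ℝ}, ContDiffOn ℝ 1 f V →
      ∃ A, ∀ t ∈ K', |f t| ≤ A ∧ ‖fderiv ℝ f t‖ ≤ A := by
    intro f hf
    obtain ⟨A₁, h₁⟩ := hK'.exists_bound_of_continuousOn (hf.continuousOn.mono hKV)
    obtain ⟨A₂, h₂⟩ := hK'.exists_bound_of_continuousOn
      ((hf.continuousOn_fderiv_of_isOpen hV le_rfl).mono hKV)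
    exact ⟨max A₁ A₂, fun t ht => ⟨(h₁ t ht).trans (le_max_left _ _),
      (h₂ t ht).trans (le_max_right _ _)⟩⟩
  obtain ⟨A₀, hA₀⟩ := hbd hD
  choose A₁ hA₁ using fun j i => hbd (hPs j i)
  set A : ℝ := |A₀| + ∑ j, ∑ i, |A₁ j i| with hA
  have hA0 : 0 ≤ A := by positivity
  have hAD : A₀ ≤ A := (le_abs_self _).trans (le_add_of_nonneg_right (by positivity))
  have hAP : ∀ j i, A₁ j i ≤ A := by
    intro j i
    have h1 : |A₁ j i| ≤ ∑ i, |A₁ j i| :=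
      Finset.single_le_sum (f := fun i => |A₁ j i|) (fun _ _ => abs_nonneg _) (Finset.mem_univ i)
    have h2 : ∑ i, |A₁ j i| ≤ ∑ j, ∑ i, |A₁ j i| :=
      Finset.single_le_sum (f := fun j => ∑ i, |A₁ j i|)
        (fun _ _ => Finset.sum_nonneg fun _ _ => abs_nonneg _) (Finset.mem_univ j)
    have h3 := le_abs_self (A₁ j i)
    have h4 := abs_nonneg A₀
    linarith
  set v := (volume K').toReal with hv
  have hv0 : 0 ≤ v := ENNReal.toReal_nonneg
  set C₁ : ℝ := m * (k * (2 * A + 2 * A ^ 3) * v) with hC₁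
  have hC₁0 : 0 ≤ C₁ := by positivity
  refine ⟨C₁ + 2 * (C₀ + v), by positivity, ?_⟩
  intro b hb hb0 hb1 hb' u hu hu1 h hh
  rcases eq_or_ne h 0 with rfl | hne
  · simp only [add_zero, sub_self, smul_zero, integral_zero, norm_zero]
    positivity
  -- With `σ = ‖h‖ ^ (1 / 12)` and `ε = σ ^ 4`, the regular part is at most `‖h‖ / ε ^ 2 = σ ^ 4`, and
  -- the weight of the singular part is at most `ε / σ ^ 2 = σ ^ 2` outside `{|D| ≤ σ}`, a set of
  -- measure `O(σ ^ γ)`.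
  have hnorm : 0 < ‖h‖ := norm_pos_iff.2 hne
  set σ : ℝ := ‖h‖ ^ (1 / 12 : ℝ) with hσ
  have hσ0 : 0 < σ := by positivity
  have hσ1 : σ ≤ 1 := Real.rpow_le_one hnorm.le hh (by norm_num)
  have hσ12 : σ ^ 12 = ‖h‖ := by
    rw [hσ, ← Real.rpow_natCast, ← Real.rpow_mul hnorm.le]; norm_num
  have hσγ : σ ^ γ = ‖h‖ ^ (γ / 12) := by
    rw [hσ, ← Real.rpow_mul hnorm.le]; congr 1; ring
  have hσle : σ ≤ σ ^ γ := by
    simpa using Real.rpow_le_rpow_of_exponent_ge hσ0 hσ1 hγ1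
  set ε : ℝ := σ ^ 4 with hε
  have hε0 : 0 < ε := by positivity
  have hε1 : ε ≤ 1 := pow_le_one₀ hσ0.le hσ1
  have hden : ∀ t, 0 < D t ^ 2 + ε := fun t => by positivity
  have hinvC : ContDiffOn ℝ 1 (fun t => (D t ^ 2 + ε)⁻¹) V :=
    ((hD.pow 2).add contDiffOn_const).inv fun t _ => (hden t).ne'
  set e : Eucl m → ℝ := fun t => b t * (D t ^ 2 + ε)⁻¹ with he
  have heC : ContDiffOn ℝ 1 e V := hb.contDiffOn.mul hinvC
  -- the regular part
  set Y : Fin m → Fin k → Eucl m → ℝ := fun j i t => b t * (D t ^ 2 + ε)⁻¹ * P j i t with hY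
  have hYC : ∀ j i, ContDiff ℝ 1 (Y j i) := fun j i =>
    contDiff_of_eq_zero hV hKc hKV (heC.mul (hPs j i)) fun t ht => by
      simp only [hY, hb0 t ht, zero_mul]
  have hY' : ∀ j i, ∀ t ∈ K', ‖fderiv ℝ (Y j i) t‖ ≤ (2 * A + 2 * A ^ 3) / ε ^ 2 := by
    intro j i t ht
    have hd : ∀ {f : Eucl m → ℝ}, ContDiffOn ℝ 1 f V → DifferentiableAt ℝ f t := fun hf =>
      (hf.contDiffAt (hV.mem_nhds (hKV ht))).differentiableAt one_ne_zero
    exact norm_fderiv_mul_inv_sq_add_mul_le hA0 hε0 hε1 (hb.differentiable one_ne_zero t) (hd hD)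
      (hd (hPs j i)) (hb1 t) (hb' t) ((hA₀ t ht).1.trans hAD) ((hA₀ t ht).2.trans hAD)
      ((hA₁ j i t ht).1.trans (hAP j i)) ((hA₁ j i t ht).2.trans (hAP j i))
  set X : Fin m → Eucl m → ℝ := fun j t => ∑ i, h i * Y j i t with hX
  have hXC : ∀ j, ContDiff ℝ 1 (X j) := fun j =>
    ContDiff.sum fun i _ => contDiff_const.mul (hYC j i)
  have hX0 : ∀ j, ∀ t ∉ K', X j t = 0 := fun j t ht => by simp [hX, hY, hb0 t ht]
  have hXd : ∀ j, ∀ t ∈ K', ‖fderiv ℝ (X j) t‖ ≤ k * (‖h‖ * ((2 * A + 2 * A ^ 3) / ε ^ 2)) := by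
    intro j t ht
    have h1 : HasFDerivAt (X j) (∑ i, h i • fderiv ℝ (Y j i) t) t :=
      HasFDerivAt.fun_sum fun i _ =>
        (((hYC j i).differentiable one_ne_zero t).hasFDerivAt).const_mul (h i)
    rw [h1.fderiv]
    refine (norm_sum_le _ _).trans ?_
    calc ∑ i, ‖h i • fderiv ℝ (Y j i) t‖ ≤ ∑ _i : Fin k, ‖h‖ * ((2 * A + 2 * A ^ 3) / ε ^ 2) := by
          refine Finset.sum_le_sum fun i _ => ?_
          rw [norm_smul]
          gcongr
          · exact PiLp.norm_apply_le h i
          · exact hY' j i t ht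
      _ = _ := by simp
  set w : Eucl m → ℝ := fun t => e t * D t ^ 2 with hw
  have hwC : ContinuousOn w V := heC.continuousOn.mul (hD.continuousOn.pow 2)
  have hw0 : ∀ t ∉ K', w t = 0 := fun t ht => by simp [hw, he, hb0 t ht]
  have hlift : ∀ t ∈ V, ∑ j, X j t • fderiv ℝ G t (EuclideanSpace.single j 1) = w t • h := by
    intro t ht
    have h1 : ∀ j, X j t • fderiv ℝ G t (EuclideanSpace.single j 1) =
        ∑ i, (h i * e t * D t) • (Z t j i • fderiv ℝ G t (EuclideanSpace.single j 1)) := by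
      intro j
      rw [hX, Finset.sum_smul]
      refine Finset.sum_congr rfl fun i _ => ?_
      rw [smul_smul]
      congr 1
      simp only [hY, hP, he]
      ring
    simp only [h1]
    rw [Finset.sum_comm]
    have h2 : ∀ i, ∑ j, (h i * e t * D t) •
        (Z t j i • fderiv ℝ G t (EuclideanSpace.single j 1)) =
          (h i * e t * D t * D t) • EuclideanSpace.single i (1 : ℝ) := fun i => by
      rw [← Finset.smul_sum, hGZ t ht, smul_smul]
    rw [Finset.sum_congr rfl fun i _ => h2 i]
    ext l
    simp only [WithLp.ofLp_sum, Finset.sum_apply, PiLp.smul_apply, PiLp.single_apply, smul_eq_mul,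
      mul_ite, mul_one, mul_zero, Finset.sum_ite_eq, Finset.mem_univ, if_true, hw]
    ring
  have hreg := norm_integral_translate_sub_le hV hK' hKV hG hXC hX0 hwC hw0 hlift hu hu1
    hXd
  -- the singular part
  set z : Eucl m → ℝ := fun t => e t * ε with hz
  have hzC : ContinuousOn z V := heC.continuousOn.mul continuousOn_const
  have hz0 : ∀ t ∉ K', z t = 0 := fun t ht => by simp [hz, he, hb0 t ht]
  have hbwz : ∀ t, b t = w t + z t := by
    intro t
    have := (hden t).ne'
    simp only [hw, hz, he]
    field_simp
  have huG : ContinuousOn (fun t => u (G t + h) - u (G t)) V :=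
    (hu.continuous.comp_continuousOn (hG.continuousOn.add continuousOn_const)).sub
      (hu.continuous.comp_continuousOn hG.continuousOn)
  have hint : ∀ {f : Eucl m → ℝ}, ContinuousOn f V → (∀ t ∉ K', f t = 0) →
      Integrable fun t => f t • (u (G t + h) - u (G t)) := fun hf h0 =>
    (continuous_of_tsupport_subset_of_eq_zero hV hKc hKV (hf.smul huG)
      fun t ht => by simp [h0 t ht]).integrable_of_hasCompactSupport
        (HasCompactSupport.intro hK' fun t ht => by simp [h0 t ht])
  have hsing : ‖∫ t, z t • (u (G t + h) - u (G t))‖ ≤ 2 * (C₀ * σ ^ γ + σ ^ 2 * v) := by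
    have hset : ∫ t, z t • (u (G t + h) - u (G t)) = ∫ t in K', z t • (u (G t + h) - u (G t)) :=
      (setIntegral_eq_integral_of_forall_compl_eq_zero fun t ht => by simp [hz0 t ht]).symm
    have hDm : MeasurableSet {t ∈ K' | |D t| ≤ σ} := by
      have hc : ContinuousOn (fun t => |D t|) K' := (hD.continuousOn.mono hKV).abs
      exact (hc.preimage_isClosed_of_isClosed hKc (isClosed_Iic (a := σ))).measurableSet
    have hzle : ∀ t ∈ K', ‖z t • (u (G t + h) - u (G t))‖ ≤
        2 * ({t ∈ K' | |D t| ≤ σ}.indicator (fun _ => 1) t + σ ^ 2) := by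
      intro t ht
      have h1 : ‖u (G t + h) - u (G t)‖ ≤ 2 := by
        refine (norm_sub_le _ _).trans ?_
        linarith [hu1 (G t + h), hu1 (G t)]
      have h2 : |z t| ≤ {t ∈ K' | |D t| ≤ σ}.indicator (fun _ => 1) t + σ ^ 2 := by
        have h3 : |z t| ≤ ε / (D t ^ 2 + ε) := by
          simp only [hz, he]
          rw [abs_mul, abs_mul, abs_inv, abs_of_pos (hden t), abs_of_pos hε0]
          calc |b t| * (D t ^ 2 + ε)⁻¹ * ε ≤ 1 * (D t ^ 2 + ε)⁻¹ * ε := by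
                gcongr
                exact hb1 t
            _ = _ := by field_simp
        by_cases hDt : |D t| ≤ σ
        · rw [indicator_of_mem (show t ∈ {t ∈ K' | |D t| ≤ σ} from ⟨ht, hDt⟩)]
          have : ε / (D t ^ 2 + ε) ≤ 1 := by
            rw [div_le_one (hden t)]; nlinarith [sq_nonneg (D t)]
          nlinarith [sq_nonneg σ]
        · rw [indicator_of_notMem (fun h => hDt h.2), zero_add]
          refine h3.trans ?_
          rw [div_le_iff₀ (hden t)]
          push Not at hDt
          have h4 : σ ^ 2 ≤ D t ^ 2 := by
            rw [← sq_abs (D t)]; gcongr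
          nlinarith [sq_nonneg σ, hε0]
      rw [norm_smul, Real.norm_eq_abs, mul_comm 2]
      exact mul_le_mul h2 h1 (norm_nonneg _) ((abs_nonneg _).trans h2)
    have h5 : (volume {t ∈ K' | |D t| ≤ σ}).toReal ≤ C₀ * σ ^ γ :=
      ENNReal.toReal_le_of_le_ofReal (by positivity) (hsub σ hσ0 hσ1)
    rw [hset]
    refine (norm_setIntegral_le_of_le_indicator_add hK' hDm (sep_subset _ _) hzle).trans ?_
    gcongr
  have hsplit : ∫ t, b t • (u (G t + h) - u (G t)) =
      (∫ t, w t • (u (G t + h) - u (G t))) + ∫ t, z t • (u (G t + h) - u (G t)) := by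
    rw [← integral_add (hint hwC hw0) (hint hzC hz0)]
    refine integral_congr_ae (Filter.Eventually.of_forall fun t => ?_)
    simp only [hbwz t, add_smul]
  have hreg' : ‖∫ t, w t • (u (G t + h) - u (G t))‖ ≤ C₁ * σ ^ 4 := by
    refine hreg.trans (le_of_eq ?_)
    rw [hC₁, ← hσ12, hε, hv]
    have : σ ^ 12 * ((2 * A + 2 * A ^ 3) / (σ ^ 4) ^ 2) = (2 * A + 2 * A ^ 3) * σ ^ 4 := by
      field_simp
    rw [this]
    ring
  have hσ4 : σ ^ 4 ≤ σ := by
    calc σ ^ 4 ≤ σ ^ 1 := pow_le_pow_of_le_one hσ0.le hσ1 (by norm_num)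
      _ = σ := pow_one σ
  have hσ2 : σ ^ 2 ≤ σ := by
    calc σ ^ 2 ≤ σ ^ 1 := pow_le_pow_of_le_one hσ0.le hσ1 (by norm_num)
      _ = σ := pow_one σ
  rw [hsplit, ← hσγ]
  refine (norm_add_le _ _).trans ?_
  have h7 : C₁ * σ ^ 4 ≤ C₁ * σ ^ γ := mul_le_mul_of_nonneg_left (hσ4.trans hσle) hC₁0
  have h8 : σ ^ 2 * v ≤ σ ^ γ * v := mul_le_mul_of_nonneg_right (hσ2.trans hσle) hv0
  calc _ ≤ C₁ * σ ^ γ + 2 * (C₀ * σ ^ γ + σ ^ γ * v) :=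
        add_le_add (hreg'.trans h7) (hsing.trans (by linarith))
    _ = _ := by ring

/-! ### Translation continuity of smooth measures on totally curved submanifolds -/

theorem IsLocalParam.mono {m d : ℕ} {S : Set (Eucl d)} {V W : Set (Eucl m)} {φ : Eucl m → Eucl d}
    (h : IsLocalParam S V φ) (hW : IsOpen W) (hWV : W ⊆ V) : IsLocalParam S W φ where
  isOpen_source := hW
  analytic := h.analytic.mono hWV
  immersion := fun t ht => h.immersion t (hWV ht)
  embedding := h.embedding.comp (Topology.IsEmbedding.inclusion hWV)
  image_open := h.exists_image_eq_inter hW hWV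

/-- Around each point a totally curved submanifold has a Lipschitz parametrization for which the Gram
determinants of all coordinate projections satisfy a sublevel estimate. -/
theorem IsTotallyCurved.exists_isLocalParam_sublevel {m n d : ℕ} (hmn : m + n = d) (hn : 4 * n ≤ d)
    {S : Set (Eucl d)} (hS : IsAnalyticSubmanifold m S) (hcurv : IsTotallyCurved m S)
    {p : Eucl d} (hp : p ∈ S) :
    ∃ (B : Set (Eucl m)) (φ : Eucl m → Eucl d), IsLocalParam S B φ ∧ p ∈ φ '' B ∧
      (∃ L : ℝ≥0, LipschitzOnWith L φ B) ∧
      ∃ γ : ℝ, 0 < γ ∧ γ ≤ 1 ∧ ∃ C : ℝ, 0 ≤ C ∧ ∀ (k : ℕ) (hk : 2 * k ≤ d) (ε : ℝ), 0 < ε → ε ≤ 1 →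
        volume {t ∈ B | |headGram hk φ t| ≤ ε} ≤ ENNReal.ofReal (C * ε ^ γ) := by
  obtain ⟨V, φ, h, t₀, ht₀, rfl⟩ := hS p hp
  have hk : ∀ k : ℕ, ∃ r > 0, ∃ γ : ℝ, 0 < γ ∧ γ ≤ 1 ∧ ∃ C : ℝ, 0 ≤ C ∧
      ∀ (hk : 2 * k ≤ d) (ε : ℝ), 0 < ε → ε ≤ 1 →
        volume {t ∈ Metric.ball t₀ r | |headGram hk φ t| ≤ ε} ≤ ENNReal.ofReal (C * ε ^ γ) := by
    intro k
    by_cases hk : 2 * k ≤ d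
    · obtain ⟨r, hr, γ, hγ, hγ1, C, hC, hle⟩ := AnalyticAt.exists_volume_sublevel_le volume
        (analyticAt_headGram hk (h.analytic t₀ ht₀))
        (hcurv.not_eventually_headGram_eq_zero hmn hn hk h ht₀)
      exact ⟨r, hr, γ, hγ, hγ1, C, hC, fun _ => hle⟩
    · exact ⟨1, one_pos, 1, one_pos, le_rfl, 0, le_rfl, fun hk' => absurd hk' hk⟩
  choose r hr γ hγ hγ1 C hC hle using hk
  obtain ⟨L, s, hs, hL⟩ := (h.hasStrictFDerivAt ht₀).exists_lipschitzOnWith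
  obtain ⟨r₀, hr₀, hball⟩ := Metric.mem_nhds_iff.1
    (Filter.inter_mem hs (h.isOpen_source.mem_nhds ht₀))
  have hne : (Finset.range (d + 1)).Nonempty := ⟨0, by simp⟩
  set ρ := min r₀ ((Finset.range (d + 1)).inf' hne r) with hρ
  have hρ0 : 0 < ρ := lt_min hr₀ ((Finset.lt_inf'_iff hne).2 fun k _ => hr k)
  set δ := (Finset.range (d + 1)).inf' hne γ with hδ
  have hδ0 : 0 < δ := (Finset.lt_inf'_iff hne).2 fun k _ => hγ k
  have hsub : Metric.ball t₀ ρ ⊆ Metric.ball t₀ r₀ := Metric.ball_subset_ball (min_le_left _ _)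
  refine ⟨Metric.ball t₀ ρ, φ, h.mono Metric.isOpen_ball fun t ht => (hball (hsub ht)).2,
    mem_image_of_mem φ (Metric.mem_ball_self hρ0), ⟨L, hL.mono fun t ht => (hball (hsub ht)).1⟩,
    δ, hδ0, (Finset.inf'_le _ (Finset.mem_range.2 (Nat.succ_pos d))).trans (hγ1 0),
    ∑ k ∈ Finset.range (d + 1), C k, Finset.sum_nonneg fun k _ => hC k, ?_⟩
  intro k hk ε hε hε1
  have hkmem : k ∈ Finset.range (d + 1) := Finset.mem_range.2 (by omega)
  calc volume {t ∈ Metric.ball t₀ ρ | |headGram hk φ t| ≤ ε}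
      ≤ volume {t ∈ Metric.ball t₀ (r k) | |headGram hk φ t| ≤ ε} := by
        refine measure_mono fun t ht => ⟨Metric.ball_subset_ball ?_ ht.1, ht.2⟩
        exact (min_le_right _ _).trans (Finset.inf'_le _ hkmem)
    _ ≤ ENNReal.ofReal (C k * ε ^ γ k) := hle k hk ε hε hε1
    _ ≤ _ := by
        apply ENNReal.ofReal_le_ofReal
        have h1 : C k ≤ ∑ k ∈ Finset.range (d + 1), C k :=
          Finset.single_le_sum (fun i _ => hC i) hkmem
        have h2 : ε ^ γ k ≤ ε ^ δ :=
          Real.rpow_le_rpow_of_exponent_ge hε hε1 (Finset.inf'_le _ hkmem)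
        exact mul_le_mul h1 h2 (by positivity) ((hC k).trans h1)

theorem IsAnalyticSubmanifold.measurableSet {m d : ℕ} {S : Set (Eucl d)}
    (hS : IsAnalyticSubmanifold m S) : MeasurableSet S := by
  have hloc : ∀ p ∈ S, ∃ A ∈ 𝓝[S] p, A ⊆ S ∧ MeasurableSet A := by
    intro p hp
    obtain ⟨V, φ, h, t, ht, rfl⟩ := hS p hp
    refine ⟨φ '' V, ?_, h.image_subset, ?_⟩
    · obtain ⟨U, hU, hSU⟩ := h.image_open
      rw [hSU]
      have : φ t ∈ S ∩ U := hSU ▸ mem_image_of_mem φ ht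
      exact Filter.inter_mem self_mem_nhdsWithin (mem_nhdsWithin_of_mem_nhds (hU.mem_nhds this.2))
    · rw [← range_domRestrict]
      exact (h.analytic.continuousOn.measurableEmbedding h.isOpen_source.measurableSet
        h.injOn).measurableSet_range
  choose! A hA hAS hAm using hloc
  obtain ⟨T, hTS, hTc, hcover⟩ := TopologicalSpace.countable_cover_nhdsWithin hA
  have : S = ⋃ p ∈ T, A p :=
    hcover.antisymm (iUnion₂_subset fun p hp => hAS p (hTS hp))
  rw [this]
  exact MeasurableSet.biUnion hTc fun p hp => hAm p (hTS hp)

/-- The translation estimate for the part of the measure seen by one chart. -/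
theorem exists_norm_integral_chart_translate_sub_le {m d : ℕ} {S K : Set (Eucl d)}
    (hK : IsCompact K) (hKS : K ⊆ S) {B : Set (Eucl m)} {φ : Eucl m → Eucl d}
    (h : IsLocalParam S B φ) {L : ℝ≥0} (hL : LipschitzOnWith L φ B) {U : Set (Eucl d)}
    (hU : IsOpen U) (hSU : S ∩ U = φ '' B) {γ : ℝ} (hγ1 : γ ≤ 1) {C₀ : ℝ} (hC₀ : 0 ≤ C₀)
    (hsub : ∀ (k : ℕ) (hk : 2 * k ≤ d) (ε : ℝ), 0 < ε → ε ≤ 1 →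
      volume {t ∈ B | |headGram hk φ t| ≤ ε} ≤ ENNReal.ofReal (C₀ * ε ^ γ))
    {χ : Eucl d → ℝ} (hχ : ContDiff ℝ ∞ χ) (hχU : tsupport χ ⊆ U) {g : Eucl d → ℝ}
    (hg : IsSmoothOnSubmanifold m S g) (hg0 : ∀ x ∈ S, 0 ≤ g x) (hgK : ∀ x ∈ S, x ∉ K → g x = 0) :
    ∃ C : ℝ, 0 ≤ C ∧ ∀ (k : ℕ) (hk : 2 * k ≤ d) (w : Eucl d → ℝ), ContDiff ℝ 1 w →
      (∀ x, |w x| ≤ 1) → (∀ x, ‖fderiv ℝ w x‖ ≤ 1) → ∀ u : Eucl k → ℂ, ContDiff ℝ 1 u →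
        (∀ y, ‖u y‖ ≤ 1) → ∀ v : Eucl k, ‖v‖ ≤ 1 →
          ‖∫ x, (χ x * w x) • (u (headCoords hk x + v) - u (headCoords hk x))
            ∂(((μHE[m] : Measure (Eucl d)).restrict S).withDensity
              fun x => ENNReal.ofReal (g x))‖ ≤ C * ‖v‖ ^ (γ / 12) := by
  have hBo := h.isOpen_source
  have hφs : ContDiffOn ℝ ∞ φ B := fun t ht => (h.analytic t ht).contDiffAt.contDiffWithinAt
  -- the compact set of parameters which matter
  set T : Set (Eucl m) := Subtype.val '' ((fun t : B => φ t) ⁻¹' (K ∩ tsupport χ)) with hT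
  have hTB : T ⊆ B := by rintro _ ⟨t, _, rfl⟩; exact t.2
  have hTc : IsCompact T := by
    refine IsCompact.image ?_ continuous_subtype_val
    refine (h.embedding.isInducing.isCompact_preimage_iff ?_).2
      (hK.inter_right (isClosed_tsupport χ))
    intro x hx
    obtain ⟨t, ht, rfl⟩ : x ∈ φ '' B := hSU ▸ ⟨hKS hx.1, hχU hx.2⟩
    exact ⟨⟨t, ht⟩, rfl⟩
  set a : Eucl m → ℝ := B.indicator fun t => χ (φ t) * (g (φ t) * volumeJacobian φ t) with ha
  have ha0 : ∀ t ∉ T, a t = 0 := by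
    intro t ht
    by_cases htB : t ∈ B
    · rw [ha, indicator_of_mem htB]
      by_cases h1 : φ t ∈ K
      · have h2 : φ t ∉ tsupport χ := fun h2 => ht ⟨⟨t, htB⟩, ⟨h1, h2⟩, rfl⟩
        rw [image_eq_zero_of_notMem_tsupport h2, zero_mul]
      · rw [hgK _ (h.image_subset (mem_image_of_mem φ htB)) h1, zero_mul, mul_zero]
    · rw [ha, indicator_of_notMem htB]
  have haB : ContDiffOn ℝ 1 a B := by
    have h1 : ContDiffOn ℝ ∞ (fun t => χ (φ t) * (g (φ t) * volumeJacobian φ t)) B :=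
      (hχ.comp_contDiffOn hφs).mul
        ((hg B φ h).mul (contDiffOn_volumeJacobian hBo hφs h.immersion))
    exact (h1.of_le (by exact_mod_cast le_top)).congr fun t ht => indicator_of_mem ht _
  have haC : ContDiff ℝ 1 a := contDiff_of_eq_zero hBo hTc.isClosed hTB haB ha0
  have hasupp : HasCompactSupport a := HasCompactSupport.intro hTc ha0
  obtain ⟨A₁, hA₁⟩ := hasupp.exists_bound_of_continuous haC.continuous
  obtain ⟨A₂, hA₂⟩ := (hasupp.fderiv ℝ).exists_bound_of_continuous (haC.continuous_fderiv one_ne_zero)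
  have hA₁0 : 0 ≤ A₁ := (norm_nonneg _).trans (hA₁ 0)
  have hA₂0 : 0 ≤ A₂ := (norm_nonneg _).trans (hA₂ 0)
  -- normalization of the densities `a * w ∘ φ`
  set N : ℝ := A₁ + A₂ + A₁ * L + 1 with hN
  have hN0 : 0 < N := by positivity
  have hloc : ∀ k : ℕ, ∃ C : ℝ, 0 ≤ C ∧ ∀ (hk : 2 * k ≤ d) (b : Eucl m → ℝ), ContDiff ℝ 1 b →
      (∀ t ∉ T, b t = 0) → (∀ t, |b t| ≤ 1) → (∀ t, ‖fderiv ℝ b t‖ ≤ 1) → ∀ u : Eucl k → ℂ,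
        ContDiff ℝ 1 u → (∀ y, ‖u y‖ ≤ 1) → ∀ v : Eucl k, ‖v‖ ≤ 1 →
          ‖∫ t, b t • (u (headCoords hk (φ t) + v) - u (headCoords hk (φ t)))‖ ≤
            C * ‖v‖ ^ (γ / 12) := by
    intro k
    by_cases hk : 2 * k ≤ d
    · have hGd : ∀ t ∈ B, ∀ x, fderiv ℝ (fun t => headCoords hk (φ t)) t x =
          headCoords hk (fderiv ℝ φ t x) := by
        intro t ht x
        have h1 : HasFDerivAt (fun t => headCoords hk (φ t)) (headCLM hk ∘L fderiv ℝ φ t) t :=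
          (headCLM hk).hasFDerivAt.comp t (h.hasStrictFDerivAt ht).hasFDerivAt
        rw [h1.fderiv]
        rfl
      obtain ⟨C, hC, hle⟩ := exists_norm_integral_smul_translate_sub_le hBo hTc hTB
        (G := fun t => headCoords hk (φ t)) (D := headGram hk φ) (Z := headLift hk φ)
        ((headCLM hk).contDiff.comp_contDiffOn (hφs.of_le (by exact_mod_cast le_top)))
        (fun t ht => (analyticAt_headGram hk (h.analytic t ht)).contDiffAt.contDiffWithinAt)
        (fun j i t ht => (analyticAt_headLift hk (h.analytic t ht) j i).contDiffAt.contDiffWithinAt)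
        (fun t ht i => by
          simp only [hGd t ht]
          exact sum_headLift_smul_fderiv hk t i)
        hγ1 hC₀ (fun ε hε hε1 => by
          have hTε : {t ∈ T | |headGram hk φ t| ≤ ε} ⊆ {t ∈ B | |headGram hk φ t| ≤ ε} :=
            fun t ht => ⟨hTB ht.1, ht.2⟩
          exact (measure_mono hTε).trans (hsub k hk ε hε hε1))
      exact ⟨C, hC, fun _ => hle⟩
    · exact ⟨0, le_rfl, fun hk' => absurd hk' hk⟩
  choose C hC hle using hloc
  refine ⟨N * ∑ k ∈ Finset.range (d + 1), C k,
    mul_nonneg hN0.le (Finset.sum_nonneg fun k _ => hC k), ?_⟩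
  intro k hk w hw hw1 hw' u hu hu1 v hv
  set b : Eucl m → ℝ := fun t => N⁻¹ * (a t * w (φ t)) with hb
  have hb0 : ∀ t ∉ T, b t = 0 := fun t ht => by simp only [hb, ha0 t ht, zero_mul, mul_zero]
  have hbC : ContDiff ℝ 1 b := by
    refine contDiff_of_eq_zero hBo hTc.isClosed hTB ?_ hb0
    exact contDiffOn_const.mul
      (haB.mul (hw.comp_contDiffOn (hφs.of_le (by exact_mod_cast le_top))))
  have hb1 : ∀ t, |b t| ≤ 1 := by
    intro t
    simp only [hb]
    rw [abs_mul, abs_mul, abs_inv, abs_of_pos hN0, inv_mul_le_iff₀ hN0, mul_one]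
    calc |a t| * |w (φ t)| ≤ A₁ * 1 := by gcongr; exacts [hA₁ t, hw1 _]
      _ ≤ N := by rw [hN]; nlinarith [mul_nonneg hA₁0 L.coe_nonneg]
  have hb' : ∀ t, ‖fderiv ℝ b t‖ ≤ 1 := by
    intro t
    by_cases ht : t ∈ T
    · have htB := hTB ht
      have hφd := (h.hasStrictFDerivAt htB).hasFDerivAt
      have hwd : HasFDerivAt (fun t => w (φ t)) (fderiv ℝ w (φ t) ∘L fderiv ℝ φ t) t :=
        (hw.differentiable one_ne_zero _).hasFDerivAt.comp t hφd
      have h1 : HasFDerivAt b (N⁻¹ • (a t • (fderiv ℝ w (φ t) ∘L fderiv ℝ φ t) +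
          w (φ t) • fderiv ℝ a t)) t :=
        ((haC.differentiable one_ne_zero t).hasFDerivAt.fun_mul hwd).const_mul _
      have hLn : ‖fderiv ℝ φ t‖ ≤ L := norm_fderiv_le_of_lipschitzOn ℝ (hBo.mem_nhds htB) hL
      have h2 : ‖fderiv ℝ w (φ t) ∘L fderiv ℝ φ t‖ ≤ 1 * L :=
        (ContinuousLinearMap.opNorm_comp_le _ _).trans
          (mul_le_mul (hw' _) hLn (norm_nonneg _) zero_le_one)
      rw [h1.fderiv, norm_smul, norm_inv, Real.norm_of_nonneg hN0.le, inv_mul_le_iff₀ hN0, mul_one]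
      refine (norm_add_le _ _).trans ?_
      rw [norm_smul, norm_smul, Real.norm_eq_abs (w (φ t))]
      calc _ ≤ A₁ * (1 * L) + 1 * A₂ := by gcongr; exacts [hA₁ t, hw1 _, hA₂ t]
        _ ≤ N := by rw [hN]; linarith
    · rw [fderiv_of_notMem_tsupport (𝕜 := ℝ)
        fun h => ht (tsupport_subset_of_eq_zero hTc.isClosed hb0 h), norm_zero]
      exact zero_le_one
  set F : Eucl d → ℂ := fun x => (χ x * w x) • (u (headCoords hk x + v) - u (headCoords hk x)) with hF
  have hFU : ∀ x ∉ U, F x = 0 := fun x hx => by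
    have : χ x = 0 := image_eq_zero_of_notMem_tsupport fun h => hx (hχU h)
    simp only [hF, this, zero_mul, zero_smul]
  have hint : ∫ x, F x ∂(((μHE[m] : Measure (Eucl d)).restrict S).withDensity
      fun x => ENNReal.ofReal (g x)) =
        N • ∫ t, b t • (u (headCoords hk (φ t) + v) - u (headCoords hk (φ t))) := by
    rw [← setIntegral_eq_integral_of_forall_compl_eq_zero (s := U) hFU,
      setIntegral_withDensity_euclideanHausdorffMeasure hBo hφs h.immersion h.injOn hL
        hU.measurableSet hSU (hg B φ h).continuousOn hg0, ← integral_smul,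
      ← setIntegral_eq_integral_of_forall_compl_eq_zero (s := B)
        (f := fun t => N • b t • (u (headCoords hk (φ t) + v) - u (headCoords hk (φ t))))
        (fun t ht => by rw [hb0 t fun h => ht (hTB h), zero_smul, smul_zero])]
    refine setIntegral_congr_fun hBo.measurableSet fun t ht => ?_
    simp only [hF, hb, ha, indicator_of_mem ht, smul_smul]
    congr 1
    field_simp
  rw [hint, norm_smul, Real.norm_of_nonneg hN0.le, mul_assoc]
  refine mul_le_mul_of_nonneg_left ((hle k hk b hbC hb0 hb1 hb' u hu hu1 v hv).trans ?_) hN0.le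
  gcongr
  exact Finset.single_le_sum (fun i _ => hC i) (Finset.mem_range.2 (by omega))

/-- Power-saving continuity under translations of the projections of a smooth measure on a totally
curved submanifold, with an exponent which depends only on the submanifold and on the compact set. -/
theorem IsTotallyCurved.exists_norm_integral_translate_sub_le {m n d : ℕ} (hmn : m + n = d)
    (hn : 4 * n ≤ d) {S : Set (Eucl d)} (hS : IsAnalyticSubmanifold m S)
    (hcurv : IsTotallyCurved m S) {K : Set (Eucl d)} (hK : IsCompact K) (hKS : K ⊆ S) :
    ∃ c : ℝ, 0 < c ∧ c ≤ 1 ∧ ∀ lam : Measure (Eucl d), IsSmoothProbabilityOn m S K lam →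
      ∃ C : ℝ, 0 ≤ C ∧ ∀ (k : ℕ) (hk : 2 * k ≤ d) (w : Eucl d → ℝ), ContDiff ℝ 1 w →
        (∀ x, |w x| ≤ 1) → (∀ x, ‖fderiv ℝ w x‖ ≤ 1) → ∀ u : Eucl k → ℂ, ContDiff ℝ 1 u →
          (∀ y, ‖u y‖ ≤ 1) → ∀ v : Eucl k, ‖v‖ ≤ 1 →
            ‖∫ x, w x • (u (headCoords hk x + v) - u (headCoords hk x)) ∂lam‖ ≤ C * ‖v‖ ^ c := by
  have hchart := fun p : K => hcurv.exists_isLocalParam_sublevel hmn hn hS (hKS p.2)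
  choose B φ hφ hmem hlip γ hγ hγ1 C₀ hC₀ hsub using hchart
  choose L hL using hlip
  choose U hU hSU using fun p => (hφ p).image_open
  have hpU : ∀ p : K, (p : Eucl d) ∈ U p := fun p =>
    ((hSU p).le (hmem p)).2
  obtain ⟨F, hF⟩ := hK.elim_finite_subcover U hU fun p hp => mem_iUnion.2 ⟨⟨p, hp⟩, hpU ⟨p, hp⟩⟩
  -- the exponent is the worst one among finitely many charts
  obtain ⟨c, hc, hc1, hcF⟩ : ∃ c : ℝ, 0 < c ∧ c ≤ 1 ∧ ∀ p ∈ F, c ≤ γ p / 12 := by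
    refine ⟨(insert 1 (F.image fun p => γ p / 12)).min' (Finset.insert_nonempty _ _), ?_, ?_, ?_⟩
    · rw [Finset.lt_min'_iff]
      intro y hy
      rcases Finset.mem_insert.1 hy with rfl | hy
      · exact one_pos
      · obtain ⟨p, _, rfl⟩ := Finset.mem_image.1 hy
        have := hγ p
        positivity
    · exact Finset.min'_le _ _ (Finset.mem_insert_self _ _)
    · intro p hp
      exact Finset.min'_le _ _ (Finset.mem_insert_of_mem (Finset.mem_image_of_mem _ hp))
  refine ⟨c, hc, hc1, ?_⟩
  obtain ⟨χ, hχ⟩ := SmoothPartitionOfUnity.exists_isSubordinate (modelWithCornersSelf ℝ (Eucl d))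
    hK.isClosed (fun p : F => U p) (fun p => hU p) (fun x hx => by
      obtain ⟨p, hp, hxp⟩ := mem_iUnion₂.1 (hF hx)
      exact mem_iUnion.2 ⟨⟨p, hp⟩, hxp⟩)
  rintro lam ⟨hprob, g, hg, hg0, hgK, rfl⟩
  have hχs : ∀ p, ContDiff ℝ ∞ (χ p) := fun p => (χ p).contMDiff.contDiff
  choose C hC hle using fun p : F => exists_norm_integral_chart_translate_sub_le hK hKS (hφ p) (hL p)
    (hU p) (hSU p).symm (hγ1 p) (hC₀ p) (hsub p) (hχs p) (hχ p) hg hg0 hgK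
  refine ⟨∑ p, C p, Finset.sum_nonneg fun p _ => hC p, ?_⟩
  intro k hk w hw hw1 hw' u hu hu1 v hv
  set lam := ((μHE[m] : Measure (Eucl d)).restrict S).withDensity fun x => ENNReal.ofReal (g x)
    with hlam
  have hKae : ∀ᵐ x ∂lam, x ∈ K := by
    rw [ae_iff]
    change lam Kᶜ = 0
    rw [hlam, withDensity_apply _ hK.isClosed.measurableSet.compl]
    refine (lintegral_congr_ae ?_).trans lintegral_zero
    have h1 := ae_restrict_mem (μ := (μHE[m] : Measure (Eucl d)).restrict S)
      hK.isClosed.measurableSet.compl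
    have h2 := ae_restrict_of_ae (s := Kᶜ) (ae_restrict_mem (μ := (μHE[m] : Measure (Eucl d)))
      hS.measurableSet)
    filter_upwards [h1, h2] with x hx hxS
    rw [hgK x hxS hx, ENNReal.ofReal_zero]
  have hsum : ∀ x ∈ K, w x • (u (headCoords hk x + v) - u (headCoords hk x)) =
      ∑ p, (χ p x * w x) • (u (headCoords hk x + v) - u (headCoords hk x)) := by
    intro x hx
    have h1 := χ.sum_eq_one hx
    rw [finsum_eq_sum_of_fintype] at h1
    rw [← Finset.sum_smul, ← Finset.sum_mul, h1, one_mul]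
  have hhead : Continuous (headCoords hk) := (headCLM hk).continuous
  have hdiff : Continuous fun x => u (headCoords hk x + v) - u (headCoords hk x) :=
    (hu.continuous.comp (hhead.add continuous_const)).sub (hu.continuous.comp hhead)
  have hi : ∀ p, Integrable
      (fun x => (χ p x * w x) • (u (headCoords hk x + v) - u (headCoords hk x))) lam := by
    intro p
    refine Integrable.of_bound (C := 1 * 1 * (1 + 1)) (((hχs p).continuous.mul hw.continuous).smul
      hdiff).aestronglyMeasurable (Filter.Eventually.of_forall fun x => ?_)
    rw [norm_smul, norm_mul, Real.norm_of_nonneg (χ.nonneg p x), Real.norm_eq_abs]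
    gcongr
    · exact χ.le_one p x
    · exact hw1 x
    · exact (norm_sub_le _ _).trans (add_le_add (hu1 _) (hu1 _))
  rw [integral_congr_ae (hKae.mono hsum), integral_finsetSum _ fun p _ => hi p, Finset.sum_mul]
  refine (norm_sum_le _ _).trans (Finset.sum_le_sum fun p _ => ?_)
  refine (hle p k hk w hw hw1 hw' u hu hu1 v hv).trans ?_
  rcases (norm_nonneg v).eq_or_lt with h0 | h0
  · have := hγ p
    rw [← h0, Real.zero_rpow (by positivity), Real.zero_rpow hc.ne']
  · exact mul_le_mul_of_nonneg_left
      (Real.rpow_le_rpow_of_exponent_ge h0 hv (hcF p p.2)) (hC p)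

/-! ### Sobolev norms -/

section SobolevNorm

variable {d : ℕ} {F : Type*} [NormedAddCommGroup F] [NormedSpace ℝ F]

theorem sum_enorm_le_sobolevNorm {j l : ℕ} (hl : l ≤ j) (f : Eucl d → F) (x : Eucl d) :
    (open Classical in ∑ w : Fin l → Fin d with Monotone w,
      ‖iteratedFDeriv ℝ l f x (fun i => EuclideanSpace.single (w i) (1 : ℝ))‖ₑ)
      ≤ sobolevNorm j f := by
  classical
  have h1 := Finset.single_le_sum (f := fun l => ∑ w : Fin l → Fin d with Monotone w,
    ⨆ x : Eucl d, ‖iteratedFDeriv ℝ l f x (fun i => EuclideanSpace.single (w i) (1 : ℝ))‖ₑ)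
    (fun _ _ => zero_le) (Finset.mem_range.2 (Nat.lt_succ_of_le hl))
  refine le_trans ?_ (le_of_le_of_eq h1 ?_)
  · refine le_of_eq_of_le ?_ (Finset.sum_le_sum fun w _ => le_iSup (fun x : Eucl d =>
      ‖iteratedFDeriv ℝ l f x (fun i => EuclideanSpace.single (w i) (1 : ℝ))‖ₑ) x)
    congr!
  · unfold sobolevNorm
    congr!

theorem enorm_le_sobolevNorm (j : ℕ) (f : Eucl d → F) (x : Eucl d) : ‖f x‖ₑ ≤ sobolevNorm j f := by
  classical
  refine le_trans ?_ (sum_enorm_le_sobolevNorm (Nat.zero_le j) f x)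
  rw [Finset.sum_eq_single (default : Fin 0 → Fin d)]
  · simp
  · intro w _ hw
    exact absurd (Subsingleton.elim _ _) hw
  · intro h
    exact absurd (Finset.mem_filter.2 ⟨Finset.mem_univ _, fun i => i.elim0⟩) h

theorem norm_le_one_of_sobolevNorm_le_one {j : ℕ} {f : Eucl d → F} (hf : sobolevNorm j f ≤ 1)
    (x : Eucl d) : ‖f x‖ ≤ 1 := by
  have := (enorm_le_sobolevNorm j f x).trans hf
  rwa [← ofReal_norm, ENNReal.ofReal_le_one] at this

theorem norm_fderiv_le_one_of_sobolevNorm_le_one {f : Eucl d → F} (hf : sobolevNorm 1 f ≤ 1)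
    (x : Eucl d) : ‖fderiv ℝ f x‖ ≤ 1 := by
  classical
  have hsum : ∑ i : Fin d, ‖fderiv ℝ f x (EuclideanSpace.single i 1)‖ ≤ 1 := by
    have h := (sum_enorm_le_sobolevNorm le_rfl f x).trans hf

    have h2 : ∑ i : Fin d, ‖fderiv ℝ f x (EuclideanSpace.single i 1)‖ₑ ≤ 1 := by
      refine le_trans (le_of_eq ?_) h
      have h3 : ∑ w : Fin 1 → Fin d,
          ‖iteratedFDeriv ℝ 1 f x (fun i => EuclideanSpace.single (w i) (1 : ℝ))‖ₑ =
          ∑ i : Fin d, ‖fderiv ℝ f x (EuclideanSpace.single i 1)‖ₑ :=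
        Fintype.sum_equiv (Equiv.funUnique (Fin 1) (Fin d)) _ _ fun w => by
          rw [iteratedFDeriv_one_apply]
          rfl
      rw [← h3]
      exact Finset.sum_congr
        (Finset.filter_true_of_mem fun w _ => Subsingleton.monotone w).symm fun _ _ => rfl
    have h4 : ENNReal.ofReal (∑ i : Fin d, ‖fderiv ℝ f x (EuclideanSpace.single i 1)‖) ≤ 1 := by
      rw [ENNReal.ofReal_sum_of_nonneg fun _ _ => norm_nonneg _]
      simpa only [ofReal_norm] using h2
    rwa [ENNReal.ofReal_le_one] at h4
  refine ContinuousLinearMap.opNorm_le_bound _ zero_le_one fun v => ?_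
  have hv : v = ∑ i : Fin d, v i • (EuclideanSpace.single i (1 : ℝ) : Eucl d) := by
    simpa using ((EuclideanSpace.basisFun (Fin d) ℝ).sum_repr v).symm
  calc ‖fderiv ℝ f x v‖ = ‖∑ i, v i • fderiv ℝ f x (EuclideanSpace.single i (1 : ℝ))‖ := by
        conv_lhs => rw [hv]
        simp only [map_sum, map_smul]
    _ ≤ ∑ i, ‖v‖ * ‖fderiv ℝ f x (EuclideanSpace.single i (1 : ℝ))‖ := by
        refine (norm_sum_le _ _).trans (Finset.sum_le_sum fun i _ => ?_)
        rw [norm_smul]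
        exact mul_le_mul_of_nonneg_right (PiLp.norm_apply_le v i) (norm_nonneg _)
    _ = ‖v‖ * ∑ i, ‖fderiv ℝ f x (EuclideanSpace.single i (1 : ℝ))‖ := by rw [Finset.mul_sum]
    _ ≤ 1 * ‖v‖ := by
        rw [one_mul]
        exact mul_le_of_le_one_right (norm_nonneg _) hsum

theorem sobolevNorm_le_ofReal {j : ℕ} {f : Eucl d → F} {A : ℝ} (hA : 0 ≤ A)
    (hf : ∀ l ≤ j, ∀ x, ‖iteratedFDeriv ℝ l f x‖ ≤ A) :
    sobolevNorm j f ≤ ENNReal.ofReal ((∑ l ∈ Finset.range (j + 1), (d : ℝ) ^ l) * A) := by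
  classical
  rw [Finset.sum_mul, ENNReal.ofReal_sum_of_nonneg fun l _ => by positivity]
  unfold sobolevNorm
  refine Finset.sum_le_sum fun l hl => ?_
  have hterm : ∀ w : Fin l → Fin d,
      ⨆ x : Eucl d, ‖iteratedFDeriv ℝ l f x (fun i => EuclideanSpace.single (w i) (1 : ℝ))‖ₑ
        ≤ ENNReal.ofReal A := by
    intro w
    refine iSup_le fun x => ?_
    rw [← ofReal_norm]
    refine ENNReal.ofReal_le_ofReal ((ContinuousMultilinearMap.le_opNorm _ _).trans ?_)
    simpa using hf l (Nat.lt_succ_iff.1 (Finset.mem_range.1 hl)) x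
  refine (Finset.sum_le_sum fun w _ => hterm w).trans ?_
  rw [Finset.sum_const, nsmul_eq_mul, ENNReal.ofReal_mul (by positivity)]
  gcongr
  rw [← ENNReal.ofReal_natCast]
  refine ENNReal.ofReal_le_ofReal ?_
  exact_mod_cast (Finset.card_filter_le _ _).trans (by simp)

end SobolevNorm

/-! ### Head and tail coordinates -/

/-- The projection of `ℝᵈ` to its last `d - k` coordinates. -/
noncomputable def tailCLM {d : ℕ} (k : ℕ) : Eucl d →L[ℝ] Eucl (d - k) :=
  LinearMap.toContinuousLinearMap
    { toFun := tailCoords k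
      map_add' := fun x y => by ext i; simp [tailCoords]
      map_smul' := fun a x => by ext i; simp [tailCoords] }

theorem tailCLM_apply {d k : ℕ} (x : Eucl d) : tailCLM k x = tailCoords k x := rfl

theorem norm_headCoords_le {d k : ℕ} (hk : 2 * k ≤ d) (x : Eucl d) : ‖headCoords hk x‖ ≤ ‖x‖ := by
  refine le_of_sq_le_sq ?_ (norm_nonneg x)
  rw [EuclideanSpace.norm_sq_eq, EuclideanSpace.norm_sq_eq]
  refine le_of_eq_of_le (Finset.sum_map Finset.univ
    (⟨fun i : Fin k => (⟨i, by omega⟩ : Fin d), fun i j h => by simpa [Fin.ext_iff] using h⟩ :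
      Fin k ↪ Fin d) (fun i => ‖x i‖ ^ 2)).symm ?_
  exact Finset.sum_le_univ_sum_of_nonneg fun i => by positivity

theorem norm_tailCoords_le {d : ℕ} (k : ℕ) (x : Eucl d) : ‖tailCoords k x‖ ≤ ‖x‖ := by
  refine le_of_sq_le_sq ?_ (norm_nonneg x)
  rw [EuclideanSpace.norm_sq_eq, EuclideanSpace.norm_sq_eq]
  refine le_of_eq_of_le (Finset.sum_map Finset.univ
    (⟨fun i : Fin (d - k) => (⟨k + i, by omega⟩ : Fin d),
      fun i j h => by simpa [Fin.ext_iff] using h⟩ :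
      Fin (d - k) ↪ Fin d) (fun i => ‖x i‖ ^ 2)).symm ?_
  exact Finset.sum_le_univ_sum_of_nonneg fun i => by positivity

/-- The inclusion of `ℝᵏ` in `ℝᵈ` as the span of the first `k` coordinates. -/
noncomputable def headInclusion {k : ℕ} (d : ℕ) : Eucl k →L[ℝ] Eucl d :=
  LinearMap.toContinuousLinearMap
    { toFun := fun x => WithLp.toLp 2 fun i : Fin d => if h : (i : ℕ) < k then x ⟨i, h⟩ else 0
      map_add' := fun x y => by
        ext i
        by_cases h : (i : ℕ) < k <;> simp [h]
      map_smul' := fun a x => by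
        ext i
        by_cases h : (i : ℕ) < k <;> simp [h] }

theorem headInclusion_apply {d k : ℕ} (x : Eucl k) (i : Fin d) :
    headInclusion d x i = if h : (i : ℕ) < k then x ⟨i, h⟩ else 0 := rfl

theorem headCoords_headInclusion_add {d k : ℕ} (hk : 2 * k ≤ d) (x : Eucl k) (p : Eucl d) :
    headCoords hk (headInclusion d x + p) = x + headCoords hk p := by
  ext i
  simp [headCoords, headInclusion_apply]

theorem tailCoords_headInclusion_add {d k : ℕ} (x : Eucl k) (p : Eucl d) :
    tailCoords k (headInclusion d x + p) = tailCoords k p := by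
  ext i
  simp [tailCoords, headInclusion_apply]

theorem exists_headCoords_eq_zero_tailCoords_eq {d k : ℕ} (hk : 2 * k ≤ d) (y : Eucl (d - k)) :
    ∃ p : Eucl d, headCoords hk p = 0 ∧ tailCoords k p = y := by
  refine ⟨WithLp.toLp 2 fun i : Fin d =>
    if h : (i : ℕ) < k then 0 else y ⟨i - k, by omega⟩, ?_, ?_⟩
  · ext i
    simp [headCoords]
  · ext i
    simp [tailCoords]

/-- A function with integral at least `1` supported in a ball of radius `R` is somewhere bounded below
by a constant depending only on `R` and on a bound for the dimension. -/
theorem exists_pos_forall_exists_le (d : ℕ) (R : ℝ) :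
    ∃ κ : ℝ, 0 < κ ∧ ∀ j ≤ d, ∀ (ρ : Eucl j → ℝ) (a : Eucl j),
      tsupport ρ ⊆ Metric.closedBall a R → 1 ≤ ∫ y, ρ y → ∃ y, κ ≤ ρ y := by
  set M : ℝ := ∑ j ∈ Finset.range (d + 1),
    (volume (Metric.closedBall (0 : Eucl j) R)).toReal with hM
  have hM0 : 0 ≤ M := Finset.sum_nonneg fun _ _ => ENNReal.toReal_nonneg
  refine ⟨1 / (1 + M), by positivity, fun j hj ρ a hsupp hint => ?_⟩
  by_contra! hlt
  have hvol : volume.real (Metric.closedBall a R) ≤ M := by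
    rw [Measure.real, Measure.addHaar_closedBall_center]
    exact Finset.single_le_sum (f := fun j =>
      (volume (Metric.closedBall (0 : Eucl j) R)).toReal) (fun _ _ => ENNReal.toReal_nonneg)
      (Finset.mem_range.2 (Nat.lt_succ_of_le hj))
  have hle : ∫ y, ρ y ≤ 1 / (1 + M) * M := by
    rw [← setIntegral_eq_integral_of_forall_compl_eq_zero (s := Metric.closedBall a R)
      fun y hy => image_eq_zero_of_notMem_tsupport fun h => hy (hsupp h)]
    by_cases hi : IntegrableOn ρ (Metric.closedBall a R)
    · calc ∫ y in Metric.closedBall a R, ρ y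
          ≤ ∫ y in Metric.closedBall a R, 1 / (1 + M) :=
            setIntegral_mono hi (integrableOn_const measure_closedBall_lt_top.ne)
              fun y => (hlt y).le
        _ = 1 / (1 + M) * volume.real (Metric.closedBall a R) := by
            rw [setIntegral_const, smul_eq_mul, mul_comm]
        _ ≤ _ := by gcongr
    · rw [integral_undef hi]
      positivity
  have : 1 / (1 + M) * M < 1 := by
    rw [one_div, inv_mul_lt_iff₀ (by positivity)]
    linarith
  linarith

/-! ### Averages at small scales -/

/-- A smooth probability density on the unit ball. -/
theorem exists_contDiff_mollifier (d : ℕ) : ∃ Φ : Eucl d → ℝ, ContDiff ℝ ∞ Φ ∧ HasCompactSupport Φ ∧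
    (∀ z, 0 ≤ Φ z) ∧ ∫ z, Φ z = 1 ∧ ∀ z, 1 ≤ ‖z‖ → Φ z = 0 := by
  let b : ContDiffBump (0 : Eucl d) := ⟨1 / 2, 1, by norm_num, by norm_num⟩
  refine ⟨b.normed volume, b.contDiff_normed, b.hasCompactSupport_normed, b.nonneg_normed,
    b.integral_normed, fun z hz => ?_⟩
  rw [← Function.notMem_support, b.support_normed_eq]
  simpa [b] using hz

theorem exists_forall_norm_iteratedFDeriv_le_of_hasCompactSupport {E F : Type*} [NormedAddCommGroup E]
    [NormedSpace ℝ E] [NormedAddCommGroup F] [NormedSpace ℝ F] {g : E → F}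
    (hg : HasCompactSupport g) (hgs : ContDiff ℝ ∞ g) (j : ℕ) :
    ∃ A : ℝ, 0 ≤ A ∧ ∀ l ≤ j, ∀ x, ‖iteratedFDeriv ℝ l g x‖ ≤ A := by
  have h : ∀ l : ℕ, ∃ A : ℝ, ∀ x, ‖iteratedFDeriv ℝ l g x‖ ≤ A := fun l =>
    (hg.iteratedFDeriv l).exists_bound_of_continuous
      (hgs.continuous_iteratedFDeriv (m := l) (by exact_mod_cast le_top))
  choose A hA using h
  refine ⟨∑ l ∈ Finset.range (j + 1), |A l|, Finset.sum_nonneg fun _ _ => abs_nonneg _,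
    fun l hl x => (hA l x).trans ((le_abs_self _).trans ?_)⟩
  exact Finset.single_le_sum (f := fun l => |A l|) (fun _ _ => abs_nonneg _)
    (Finset.mem_range.2 (Nat.lt_succ_of_le hl))

theorem norm_iteratedFDeriv_comp_smul_sub_le {E F : Type*} [NormedAddCommGroup E]
    [NormedSpace ℝ E] [NormedAddCommGroup F] [NormedSpace ℝ F] {g : E → F} (hg : ContDiff ℝ ∞ g)
    (r : ℝ) (x y : E) (l : ℕ) :
    ‖iteratedFDeriv ℝ l (fun y => g (r • (y - x))) y‖
      ≤ ‖iteratedFDeriv ℝ l g (r • (y - x))‖ * |r| ^ l := by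
  have h1 : iteratedFDeriv ℝ l (fun y => g (r • (y - x))) y
      = iteratedFDeriv ℝ l (g ∘ (r • ContinuousLinearMap.id ℝ E)) (y - x) :=
    iteratedFDeriv_comp_sub (f := g ∘ (r • ContinuousLinearMap.id ℝ E)) l x y
  rw [h1, ContinuousLinearMap.iteratedFDeriv_comp_right _ hg _ (by exact_mod_cast le_top)]
  refine (ContinuousMultilinearMap.norm_compContinuousLinearMap_le _ _).trans ?_
  rw [Finset.prod_const, Finset.card_univ, Fintype.card_fin]
  refine mul_le_mul_of_nonneg_left (pow_le_pow_left₀ (norm_nonneg _) ?_ l) (norm_nonneg _)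
  rw [norm_smul, Real.norm_eq_abs]
  exact mul_le_of_le_one_right (abs_nonneg r) ContinuousLinearMap.norm_id_le

/-- Averages of a function at scale `δ` are controlled by its pairings with test functions: the test
function `g (δ⁻¹ (· - x))` has Sobolev norm `O(δ⁻⁴ᵈ)`, and rescaling the integral costs `δ⁻ᵈ`. -/
theorem norm_integral_mul_comp_add_smul_le {d : ℕ} {f : Eucl d → ℂ} (hf : Continuous f) {τ : ℝ}
    (hτ : 0 ≤ τ)
    (heq : ∀ ψ : Eucl d → ℂ, ContDiff ℝ ∞ ψ → Integrable (fun x => f x * ψ x) →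
      ‖∫ x, f x * ψ x‖ₑ ≤ ENNReal.ofReal τ * sobolevNorm (4 * d) ψ)
    {g : Eucl d → ℂ} (hg : ContDiff ℝ ∞ g) (hgc : HasCompactSupport g) {A : ℝ} (hA0 : 0 ≤ A)
    (hA : ∀ l ≤ 4 * d, ∀ x, ‖iteratedFDeriv ℝ l g x‖ ≤ A) {δ : ℝ} (hδ : 0 < δ) (hδ1 : δ ≤ 1)
    (x : Eucl d) :
    ‖∫ z, f (x + δ • z) * g z‖ ≤
      (∑ l ∈ Finset.range (4 * d + 1), (d : ℝ) ^ l) * A * (δ⁻¹ ^ (5 * d) * τ) := by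
  set M : ℝ := ∑ l ∈ Finset.range (4 * d + 1), (d : ℝ) ^ l with hM
  have hM0 : 0 ≤ M := Finset.sum_nonneg fun _ _ => by positivity
  have hδ' : 1 ≤ δ⁻¹ := (one_le_inv₀ hδ).2 hδ1
  set ψ : Eucl d → ℂ := fun y => g (δ⁻¹ • (y - x)) with hψ
  have hψs : ContDiff ℝ ∞ ψ := hg.comp (by fun_prop)
  let e : Eucl d ≃ₜ Eucl d :=
    (Homeomorph.subRight x).trans (Homeomorph.smulOfNeZero δ⁻¹ (inv_ne_zero hδ.ne'))
  have hψc : HasCompactSupport ψ := hgc.comp_homeomorph e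
  have hint : Integrable (fun y => f y * ψ y) :=
    (hf.mul hψs.continuous).integrable_of_hasCompactSupport hψc.mul_left
  have hS : sobolevNorm (4 * d) ψ ≤ ENNReal.ofReal (M * (A * δ⁻¹ ^ (4 * d))) := by
    refine sobolevNorm_le_ofReal (by positivity) fun l hl y => ?_
    refine (norm_iteratedFDeriv_comp_smul_sub_le hg _ _ _ _).trans ?_
    rw [abs_of_pos (inv_pos.2 hδ)]
    exact mul_le_mul (hA l hl _) (pow_le_pow_right₀ hδ' hl) (by positivity) hA0
  have h1 : ‖∫ y, f y * ψ y‖ ≤ τ * (M * (A * δ⁻¹ ^ (4 * d))) := by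
    have h := (heq ψ hψs hint).trans (mul_le_mul_right hS _)
    rw [← ENNReal.ofReal_mul hτ, ← ofReal_norm] at h
    exact (ENNReal.ofReal_le_ofReal_iff (by positivity)).1 h
  have h2 : ∫ z, f (x + δ • z) * g z = δ⁻¹ ^ d • ∫ y, f y * ψ y := by
    rw [← integral_add_left_eq_self (fun y => f y * ψ y) x]
    have h := Measure.integral_comp_smul volume (fun w => f (x + w) * ψ (x + w)) δ
    rw [finrank_euclideanSpace_fin, abs_of_pos (by positivity), ← inv_pow] at h
    rw [← h]
    refine integral_congr_ae (Filter.Eventually.of_forall fun z => ?_)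
    simp only [hψ, add_sub_cancel_left, smul_smul, inv_mul_cancel₀ hδ.ne', one_smul]
  rw [h2, norm_smul, Real.norm_of_nonneg (by positivity)]
  calc δ⁻¹ ^ d * ‖∫ y, f y * ψ y‖ ≤ δ⁻¹ ^ d * (τ * (M * (A * δ⁻¹ ^ (4 * d)))) := by gcongr
    _ = M * A * (δ⁻¹ ^ (5 * d) * τ) := by
        rw [show 5 * d = d + 4 * d by ring, pow_add]
        ring

/-! ### Singular functions -/

/-- If the averages of `f` at scale `δ` are small, and if integrals against `lam` of functions of the
head coordinates are almost invariant under translations of length at most `δ`, then the integral of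
`f` against `lam` is small. -/
theorem norm_integral_le_of_norm_average_le {d k : ℕ} (hk : 2 * k ≤ d) {lam : Measure (Eucl d)}
    [IsProbabilityMeasure lam] {f : Eucl d → ℂ} (hf : ContDiff ℝ 1 f) (hf1 : ∀ x, ‖f x‖ ≤ 1)
    {ft : Eucl k → ℂ} {ρ : Eucl (d - k) → ℝ}
    (hfac : ∀ x, f x = ft (headCoords hk x) * (ρ (tailCoords k x) : ℂ))
    (hρ : ContDiff ℝ 1 ρ) (hρ1 : ∀ y, |ρ y| ≤ 1) (hρ' : ∀ y, ‖fderiv ℝ ρ y‖ ≤ 1)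
    {κ : ℝ} (hκ : 0 < κ) {y₀ : Eucl (d - k)} (hy₀ : κ ≤ ρ y₀)
    {Φ : Eucl d → ℝ} (hΦc : Continuous Φ) (hΦs : HasCompactSupport Φ) (hΦ0 : ∀ z, 0 ≤ Φ z)
    (hΦ1 : ∫ z, Φ z = 1) (hΦ : ∀ z, 1 ≤ ‖z‖ → Φ z = 0) {δ E B : ℝ} (hδ : 0 < δ)
    (hE : ∀ x, ‖∫ z, f (x + δ • z) * (Φ z : ℂ)‖ ≤ E)
    (hB : ∀ u : Eucl k → ℂ, ContDiff ℝ 1 u → (∀ y, ‖u y‖ ≤ 1) → ∀ v : Eucl k, ‖v‖ ≤ δ →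
      ‖∫ x, ρ (tailCoords k x) • (u (headCoords hk x + v) - u (headCoords hk x)) ∂lam‖ ≤ B) :
    ‖∫ x, f x ∂lam‖ ≤ κ⁻¹ * (E + κ⁻¹ * δ + B) := by
  obtain ⟨p, hp1, hp2⟩ := exists_headCoords_eq_zero_tailCoords_eq hk y₀
  have hρ₀ : 0 < ρ y₀ := hκ.trans_le hy₀
  have hhead : Continuous (headCoords hk : Eucl d → Eucl k) := (headCLM hk).continuous
  have htail : Continuous (tailCoords k : Eucl d → Eucl (d - k)) := (tailCLM k).continuous
  have hheadadd : ∀ (x z : Eucl d), headCoords hk (x + δ • z)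
      = headCoords hk x + δ • headCoords hk z := fun x z => by
    simp only [← headCLM_apply, map_add, map_smul]
  have htailadd : ∀ (x z : Eucl d), tailCoords k (x + δ • z)
      = tailCoords k x + δ • tailCoords k z := fun x z => by
    simp only [← tailCLM_apply, map_add, map_smul]
  -- `f` restricted to a slice on which the cutoff is not small
  set u : Eucl k → ℂ := fun y => f (headInclusion d y + p) with hu
  have huft : ∀ y, u y = ft y * (ρ y₀ : ℂ) := fun y => by
    simp only [hu]
    rw [hfac, headCoords_headInclusion_add, tailCoords_headInclusion_add, hp1, hp2, add_zero]
  have hus : ContDiff ℝ 1 u := hf.comp ((headInclusion d).contDiff.add contDiff_const)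
  have hu1 : ∀ y, ‖u y‖ ≤ 1 := fun y => hf1 _
  have hfu : ∀ x, (ρ y₀ : ℂ) * f x = (ρ (tailCoords k x) : ℂ) * u (headCoords hk x) := fun x => by
    rw [hfac, huft]
    ring
  have hΦi : Integrable Φ := hΦc.integrable_of_hasCompactSupport hΦs
  have hΦ1' : ∫ z, (Φ z : ℂ) = 1 := by rw [integral_complex_ofReal, hΦ1, Complex.ofReal_one]
  have hLip : ∀ y z, |ρ y - ρ z| ≤ ‖y - z‖ := fun y z => by
    simpa using Convex.norm_image_sub_le_of_norm_fderiv_le (𝕜 := ℝ)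
      (fun x _ => (hρ.differentiable one_ne_zero).differentiableAt) (fun x _ => hρ' x) convex_univ
      (mem_univ z) (mem_univ y)
  have hint : ∀ {w : Eucl d → ℂ}, Continuous w → Integrable fun z => w z * (Φ z : ℂ) :=
    fun {w} hw => (hw.mul (Complex.continuous_ofReal.comp hΦc)).integrable_of_hasCompactSupport
      ((hΦs.comp_left (g := ((↑) : ℝ → ℂ)) Complex.ofReal_zero).mul_left)
  -- averages of `u` are small, because the cutoff varies by at most `δ` at scale `δ`
  have hV : ∀ y : Eucl k, ‖∫ z, u (y + δ • headCoords hk z) * (Φ z : ℂ)‖ ≤ E + κ⁻¹ * δ := by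
    intro y
    have hsplit : (ρ y₀ : ℂ) * ∫ z, u (y + δ • headCoords hk z) * (Φ z : ℂ)
        = (ρ y₀ : ℂ) * (∫ z, f (headInclusion d y + p + δ • z) * (Φ z : ℂ))
          - ∫ z, u (y + δ • headCoords hk z)
            * ((ρ (y₀ + δ • tailCoords k z) : ℂ) - (ρ y₀ : ℂ)) * (Φ z : ℂ) := by
      have hρc := hρ.continuous
      have huc := hus.continuous
      have hfc := hf.continuous
      rw [← integral_const_mul, ← integral_const_mul, ← integral_sub
        ((hint (by fun_prop)).const_mul _) (hint (by fun_prop))]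
      refine integral_congr_ae (Filter.Eventually.of_forall fun z => ?_)
      have h := hfu (headInclusion d y + p + δ • z)
      rw [hheadadd, htailadd, headCoords_headInclusion_add, tailCoords_headInclusion_add, hp1, hp2,
        add_zero] at h
      beta_reduce
      linear_combination (-(Φ z : ℂ)) * h
    have hrem : ‖∫ z, u (y + δ • headCoords hk z)
        * ((ρ (y₀ + δ • tailCoords k z) : ℂ) - (ρ y₀ : ℂ)) * (Φ z : ℂ)‖ ≤ δ := by
      calc _ ≤ ∫ z, δ * Φ z := by
            refine norm_integral_le_of_norm_le (hΦi.const_mul δ)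
              (Filter.Eventually.of_forall fun z => ?_)
            rcases le_total 1 ‖z‖ with hz | hz
            · simp [hΦ z hz]
            rw [norm_mul, norm_mul, Complex.norm_real, Real.norm_of_nonneg (hΦ0 z),
              ← Complex.ofReal_sub, Complex.norm_real, Real.norm_eq_abs]
            refine mul_le_mul_of_nonneg_right ?_ (hΦ0 z)
            calc _ ≤ 1 * (δ * 1) := by
                  refine mul_le_mul (hu1 _) ((hLip _ _).trans ?_) (abs_nonneg _) zero_le_one
                  rw [add_sub_cancel_left, norm_smul, Real.norm_of_nonneg hδ.le]
                  gcongr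
                  exact (norm_tailCoords_le k z).trans hz
              _ = δ := by ring
        _ = δ := by rw [integral_const_mul, hΦ1, mul_one]
    have hmul : ρ y₀ * ‖∫ z, u (y + δ • headCoords hk z) * (Φ z : ℂ)‖ ≤ ρ y₀ * E + δ := by
      calc _ = ‖(ρ y₀ : ℂ) * ∫ z, u (y + δ • headCoords hk z) * (Φ z : ℂ)‖ := by
            rw [norm_mul, Complex.norm_real, Real.norm_of_nonneg hρ₀.le]
        _ ≤ _ := by
            rw [hsplit]
            refine (norm_sub_le _ _).trans (add_le_add ?_ hrem)
            rw [norm_mul, Complex.norm_real, Real.norm_of_nonneg hρ₀.le]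
            exact mul_le_mul_of_nonneg_left (hE _) hρ₀.le
    have h1 : ‖∫ z, u (y + δ • headCoords hk z) * (Φ z : ℂ)‖ ≤ E + (ρ y₀)⁻¹ * δ := by
      refine le_of_mul_le_mul_left (hmul.trans (le_of_eq ?_)) hρ₀
      field_simp
    refine h1.trans ?_
    gcongr
  -- the translation differences, averaged against the mollifier
  set D : Eucl d → Eucl d → ℂ := fun x z =>
    ρ (tailCoords k x) • (u (headCoords hk x + δ • headCoords hk z) - u (headCoords hk x))
      * (Φ z : ℂ) with hD
  have hcont : Continuous (Function.uncurry D) := by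
    have hρc := hρ.continuous
    have huc := hus.continuous
    simp only [hD, Function.uncurry_def]
    fun_prop
  have hDint : Integrable (Function.uncurry D) (lam.prod volume) := by
    refine ((hΦi.const_mul 2).comp_snd lam).mono' hcont.aestronglyMeasurable
      (Filter.Eventually.of_forall fun q => ?_)
    simp only [hD, Function.uncurry_def]
    rw [norm_mul, norm_smul, Complex.norm_real, Real.norm_of_nonneg (hΦ0 _), Real.norm_eq_abs]
    refine mul_le_mul_of_nonneg_right ?_ (hΦ0 _)
    calc _ ≤ 1 * (1 + 1 : ℝ) := mul_le_mul (hρ1 _)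
          ((norm_sub_le _ _).trans (add_le_add (hu1 _) (hu1 _))) (norm_nonneg _) zero_le_one
      _ = 2 := by norm_num
  have hDle : ‖∫ x, (∫ z, D x z) ∂lam‖ ≤ B := by
    rw [integral_integral_swap hDint]
    calc _ ≤ ∫ z, B * Φ z := by
          refine norm_integral_le_of_norm_le (hΦi.const_mul B)
            (Filter.Eventually.of_forall fun z => ?_)
          rcases le_total 1 ‖z‖ with hz | hz
          · simp [hD, hΦ z hz]
          simp only [hD]
          rw [integral_mul_const, norm_mul, Complex.norm_real, Real.norm_of_nonneg (hΦ0 z)]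
          refine mul_le_mul_of_nonneg_right (hB u hus hu1 _ ?_) (hΦ0 z)
          rw [norm_smul, Real.norm_of_nonneg hδ.le]
          exact mul_le_of_le_one_right hδ.le ((norm_headCoords_le hk z).trans hz)
      _ = B := by rw [integral_const_mul, hΦ1, mul_one]
  have hpt : ∀ x, (ρ y₀ : ℂ) * f x + ∫ z, D x z = (ρ (tailCoords k x) : ℂ) *
      ∫ z, u (headCoords hk x + δ • headCoords hk z) * (Φ z : ℂ) := by
    intro x
    have huc := hus.continuous
    have h1 : (ρ y₀ : ℂ) * f x = ∫ z, (ρ y₀ : ℂ) * f x * (Φ z : ℂ) := by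
      rw [integral_const_mul, hΦ1', mul_one]
    rw [h1, ← integral_const_mul, ← integral_add (hint (by fun_prop)) (hint (by fun_prop))]
    refine integral_congr_ae (Filter.Eventually.of_forall fun z => ?_)
    simp only [hfu, Complex.real_smul]
    ring
  have hfi : Integrable (fun x => (ρ y₀ : ℂ) * f x) lam :=
    (Integrable.of_bound hf.continuous.aestronglyMeasurable 1
      (Filter.Eventually.of_forall hf1)).const_mul _
  have hsum : (ρ y₀ : ℂ) * ∫ x, f x ∂lam = (∫ x, (ρ (tailCoords k x) : ℂ) *
      (∫ z, u (headCoords hk x + δ • headCoords hk z) * (Φ z : ℂ)) ∂lam) - ∫ x, (∫ z, D x z) ∂lam := by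
    have hDi : Integrable (fun x => ∫ z, D x z) lam := hDint.integral_prod_left
    rw [eq_sub_iff_add_eq, ← integral_const_mul, ← integral_add hfi hDi]
    exact integral_congr_ae (Filter.Eventually.of_forall hpt)
  have hmain : ρ y₀ * ‖∫ x, f x ∂lam‖ ≤ E + κ⁻¹ * δ + B := by
    calc _ = ‖(ρ y₀ : ℂ) * ∫ x, f x ∂lam‖ := by
          rw [norm_mul, Complex.norm_real, Real.norm_of_nonneg hρ₀.le]
      _ ≤ _ := by
          rw [hsum]
          refine (norm_sub_le _ _).trans (add_le_add ?_ hDle)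
          refine (norm_integral_le_of_norm_le_const (C := E + κ⁻¹ * δ)
            (Filter.Eventually.of_forall fun x => ?_)).trans (by simp)
          rw [norm_mul, Complex.norm_real]
          calc _ ≤ 1 * (E + κ⁻¹ * δ) :=
                mul_le_mul (hρ1 _) (hV _) (norm_nonneg _) zero_le_one
            _ = _ := one_mul _
  rw [inv_mul_eq_div, le_div_iff₀ hκ, mul_comm]
  exact (mul_le_mul_of_nonneg_right hy₀ (norm_nonneg _)).trans hmain

theorem mainTheorem7 (d m n : ℕ) (hmn : m + n = d) (hn : 4 * n ≤ d)
    (S : Set (Eucl d)) (hS : IsAnalyticSubmanifold m S) (hcurv : IsTotallyCurved m S)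
    (K : Set (Eucl d)) (hK : IsCompact K) (hKS : K ⊆ S) (α : ℝ) (hα : 0 < α) :
    ∃ c : ℝ, 0 < c ∧
      ∀ lam : Measure (Eucl d), IsSmoothProbabilityOn m S K lam →
        ∀ R : ℝ, ∃ C : ℝ, ∀ T : ℝ, 0 < T → ∀ f : Eucl d → ℂ, IsSingularFunction T α R f →
          ‖∫ x, f x ∂lam‖ ≤ C * T ^ (-c) := by
  obtain ⟨c, hc, hc1, htrans⟩ :=
    hcurv.exists_norm_integral_translate_sub_le hmn hn hS hK hKS
  obtain ⟨Φ, hΦ, hΦs, hΦ0, hΦ1, hΦz⟩ := exists_contDiff_mollifier d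
  have hΦC : ContDiff ℝ ∞ fun z => (Φ z : ℂ) := Complex.ofRealCLM.contDiff.comp hΦ
  have hΦCs : HasCompactSupport fun z => (Φ z : ℂ) :=
    hΦs.comp_left (g := ((↑) : ℝ → ℂ)) Complex.ofReal_zero
  obtain ⟨A, hA0, hA⟩ :=
    exists_forall_norm_iteratedFDeriv_le_of_hasCompactSupport hΦCs hΦC (4 * d)
  set M : ℝ := ∑ l ∈ Finset.range (4 * d + 1), (d : ℝ) ^ l with hM
  have hM0 : 0 ≤ M := Finset.sum_nonneg fun _ _ => by positivity
  -- the scale `δ = T ^ (-β)` balances `δ⁻⁵ᵈ T ^ (-α)` against `δ`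
  set β : ℝ := α / (5 * d + 1) with hβ
  have hβ0 : 0 < β := by positivity
  refine ⟨β * c, by positivity, fun lam hlam R => ?_⟩
  have := hlam.1
  obtain ⟨C, hC0, hC⟩ := htrans lam hlam
  obtain ⟨κ, hκ, hκle⟩ := exists_pos_forall_exists_le d R
  refine ⟨κ⁻¹ * (M * A + κ⁻¹ + C) + 1, fun T hT f hf => ?_⟩
  have hf1 : ∀ x, ‖f x‖ ≤ 1 := norm_le_one_of_sobolevNorm_le_one hf.norm_zero
  have hconst : 0 ≤ κ⁻¹ * (M * A + κ⁻¹ + C) := by positivity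
  rcases lt_or_ge T 1 with hT1 | hT1
  · -- for small `T` the bound is weaker than the trivial one
    have h1 : ‖∫ x, f x ∂lam‖ ≤ 1 :=
      (norm_integral_le_of_norm_le_const (Filter.Eventually.of_forall hf1)).trans (by simp)
    have h2 : 1 ≤ T ^ (-(β * c)) :=
      Real.one_le_rpow_of_pos_of_le_one_of_nonpos hT hT1.le (by nlinarith)
    nlinarith
  obtain ⟨k, hk, ft, ρ, hfac, hρ, ⟨a, ha⟩, hρ1, hρint⟩ := hf.factorization
  obtain ⟨y₀, hy₀⟩ := hκle (d - k) (Nat.sub_le d k) ρ a ha hρint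
  have hρC1 : ContDiff ℝ 1 ρ := hρ.of_le (by exact_mod_cast le_top)
  have hρb : ∀ y, |ρ y| ≤ 1 := norm_le_one_of_sobolevNorm_le_one hρ1
  have hρ' : ∀ y, ‖fderiv ℝ ρ y‖ ≤ 1 := norm_fderiv_le_one_of_sobolevNorm_le_one hρ1
  set δ : ℝ := T ^ (-β) with hδ
  have hδ0 : 0 < δ := Real.rpow_pos_of_pos hT _
  have hδ1 : δ ≤ 1 := Real.rpow_le_one_of_one_le_of_nonpos hT1 (by linarith)
  have hδα : δ⁻¹ ^ (5 * d) * T ^ (-α) = δ := by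
    rw [hδ, ← Real.rpow_neg hT.le, neg_neg, ← Real.rpow_natCast, ← Real.rpow_mul hT.le,
      ← Real.rpow_add hT]
    congr 1
    rw [hβ]
    push_cast
    field_simp
    ring
  have hδc : δ ≤ δ ^ c := by
    simpa using Real.rpow_le_rpow_of_exponent_ge hδ0 hδ1 hc1
  have hδcT : δ ^ c = T ^ (-(β * c)) := by rw [hδ, ← Real.rpow_mul hT.le, neg_mul]
  have hE : ∀ x, ‖∫ z, f (x + δ • z) * (Φ z : ℂ)‖ ≤ M * A * δ := fun x => by
    have h := norm_integral_mul_comp_add_smul_le hf.contDiff.continuous (Real.rpow_nonneg hT.le (-α))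
      hf.equidistributed hΦC hΦCs hA0 hA hδ0 hδ1 x
    rwa [hδα] at h
  have hw' : ∀ x, ‖fderiv ℝ (fun x => ρ (tailCoords k x)) x‖ ≤ 1 := fun x => by
    have h : HasFDerivAt (fun x => ρ (tailCoords k x))
        ((fderiv ℝ ρ (tailCoords k x)).comp (tailCLM k)) x :=
      ((hρC1.differentiable one_ne_zero).differentiableAt.hasFDerivAt).comp x
        (tailCLM k).hasFDerivAt
    rw [h.fderiv]
    refine (ContinuousLinearMap.opNorm_comp_le _ _).trans (mul_le_one₀ (hρ' _) (norm_nonneg _) ?_)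
    exact ContinuousLinearMap.opNorm_le_bound _ zero_le_one fun z => by
      simpa only [one_mul, tailCLM_apply] using norm_tailCoords_le k z
  have hB : ∀ u : Eucl k → ℂ, ContDiff ℝ 1 u → (∀ y, ‖u y‖ ≤ 1) → ∀ v : Eucl k, ‖v‖ ≤ δ →
      ‖∫ x, ρ (tailCoords k x) • (u (headCoords hk x + v) - u (headCoords hk x)) ∂lam‖
        ≤ C * δ ^ c := fun u hu hu1 v hv =>
    (hC k hk (fun x => ρ (tailCoords k x)) (hρC1.comp (tailCLM k).contDiff) (fun x => hρb _) hw' u hu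
      hu1 v (hv.trans hδ1)).trans (by gcongr)
  calc ‖∫ x, f x ∂lam‖ ≤ κ⁻¹ * (M * A * δ + κ⁻¹ * δ + C * δ ^ c) :=
        norm_integral_le_of_norm_average_le hk hf.contDiff hf1 hfac hρC1 hρb hρ' hκ hy₀
          hΦ.continuous hΦs hΦ0 hΦ1 hΦz hδ0 hE hB
    _ ≤ κ⁻¹ * (M * A * δ ^ c + κ⁻¹ * δ ^ c + C * δ ^ c) := by gcongr
    _ = κ⁻¹ * (M * A + κ⁻¹ + C) * T ^ (-(β * c)) := by
        rw [← hδcT]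
        ring
    _ ≤ (κ⁻¹ * (M * A + κ⁻¹ + C) + 1) * T ^ (-(β * c)) := by
        gcongr
        linarith
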